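/- Let $d\ge 2$ and let $V$ be the flip operator on $\mathbb{C}^d\otimes\mathbb{C}^d$, $V|ij\rangle=|ji\rangle$. A state is a positive semidefinite operator of trace one; a bipartite state is separable if it is a finite convex combination of product states $\rho_A\otimes\rho_B$, and entangled otherwise. A Werner state is a state $W$ on $\mathbb{C}^d\otimes\mathbb{C}^d$ with $(U\otimes U)W(U^\dagger\otimes U^\dagger)=W$ for all unitaries $U$. A projective measurement is a finite family $\{P_i\}$ of mutually orthogonal orthogonal projections (of arbitrary rank) with $\sum_i P_i=I$. A state $\rho$ admits a local model for projective measurements if there are a probability space $(\Lambda,\pi)$ and response functions $p_A,p_B$ (for every measurement and every $\lambda\in\Lambda$ a probability distribution on the outcomes, measurable in $\lambda$) such that, for all projective measurements $\{P_i\},\{Q_j\}$ and all outcomes $a,b$, $$\mathrm{tr}(\rho\,P_a\otimes Q_b)=\int_\Lambda p_A(a,\lambda,\{P_i\})\,p_B(b,\lambda,\{Q_j\})\,d\pi(\lambda).\qquad(\ast)$$ Werner's model. Let $\Lambda$ be the unit sphere of $\mathbb{C}^d$ and let $\pi$ be its uniform distribution (normalised surface measure). Bob responds by the Born rule, $p_B(b,\lambda,\{Q_j\})=\langle\lambda|Q_b|\lambda\rangle$.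 If all $P_i$ are one-dimensional, Alice's response satisfies $p_A(a,\lambda,\{P_i\})=1$ if $\langle\lambda|P_a|\lambda\rangle<\langle\lambda|P_k|\lambda\rangle$ for all $k\ne a$, and $p_A(a,\lambda,\{P_i\})=0$ if $\langle\lambda|P_a|\lambda\rangle>\langle\lambda|P_k|\lambda\rangle$ for some $k\neq a$; at ties it is arbitrary (subject to being a measurable response function). If the $P_i$ have arbitrary rank, there is a refinement of $\{P_i\}$ into one-dimensional projections $R_1,\dots,R_d$ forming a projective measurement, so that every $P_a$ is the sum of the $R_k$ assigned to $a$, and $p_A(a,\lambda,\{P_i\})$ is the sum of $p_A(k,\lambda,\{R_j\})$ over the $k$ assigned to $a$. Then: 1. $\pi$ is a probability measure invariant under all unitaries of $\mathbb{C}^d$, and for every measurement $\{P_i\}$ by one-dimensional projections the minimiser of $a\mapsto\langle\lambda|P_a|\lambda\rangle$ is unique for $\pi$-almost every $\lambda$. 2. Response functions $p_A$ as described exist, and for every such $p_A$ the equality $(\ast)$ holds, for every pair of projective measurements and all outcomes, with $\rho$ equal to $$W_{local}=\frac{d+1}{d^3}\,I-\frac1{d^2}\,V .$$ 3. $W_{local}$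 is the unique Werner state with $\phi=\mathrm{tr}(VW)=-1+\frac{d+1}{d^2}$. 4. This value of $\phi$ is negative, and $W_{local}$ is an entangled state that admits a local model for projective measurements. -/

import Mathlib

open MeasureTheory Matrix
open scoped Kronecker ComplexOrder

namespace WernerModel

noncomputable section

/-- A quantum state (density operator), written as a matrix: positive semidefinite, trace one. -/
def IsState {m : Type} [Fintype m] (ρ : Matrix m m ℂ) : Prop :=
  ρ.PosSemidef ∧ ρ.trace = 1

/-- A bipartite state is separable if it is a (finite) convex combination of product states. -/
def IsSeparable {m n : Type} [Fintype m] [Fintype n] (ρ : Matrix (m × n) (m × n) ℂ) : Prop :=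
  ∃ (N : ℕ) (p : Fin N → ℝ) (ρA : Fin N → Matrix m m ℂ) (ρB : Fin N → Matrix n n ℂ),
    (∀ i, 0 ≤ p i) ∧ ∑ i, p i = 1 ∧ (∀ i, IsState (ρA i)) ∧ (∀ i, IsState (ρB i)) ∧
      ρ = ∑ i, (p i : ℂ) • (ρA i ⊗ₖ ρB i)

/-- An entangled state is a state which is not separable. -/
def IsEntangled {m n : Type} [Fintype m] [Fintype n] (ρ : Matrix (m × n) (m × n) ℂ) : Prop :=
  IsState ρ ∧ ¬ IsSeparable ρ

/-- The flip operator `V |ij⟩ = |ji⟩` on `ℂ^d ⊗ ℂ^d`. -/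
def flipOperator (d : ℕ) : Matrix (Fin d × Fin d) (Fin d × Fin d) ℂ :=
  Matrix.of fun r s => if r = s.swap then 1 else 0

/-- A Werner state is a state on `ℂ^d ⊗ ℂ^d` that is invariant under all `U ⊗ U`, `U` unitary. -/
def IsWernerState {d : ℕ} (W : Matrix (Fin d × Fin d) (Fin d × Fin d) ℂ) : Prop :=
  IsState W ∧ ∀ U ∈ Matrix.unitaryGroup (Fin d) ℂ, (U ⊗ₖ U) * W * (Uᴴ ⊗ₖ Uᴴ) = W

/-- The state `((d+1)/d³) I - V/d²`. -/
def wernerLocal (d : ℕ) : Matrix (Fin d × Fin d) (Fin d × Fin d) ℂ :=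
  (((d : ℂ) + 1) / (d : ℂ) ^ 3) • (1 : Matrix (Fin d × Fin d) (Fin d × Fin d) ℂ)
    - (1 / (d : ℂ) ^ 2) • flipOperator d

/-- A projective measurement with outcomes in `ι`: mutually orthogonal orthogonal projections
(of any rank) that sum to the identity. -/
structure ProjMeasurement (m : Type) [Fintype m] [DecidableEq m] (ι : Type) [Fintype ι] where
  proj : ι → Matrix m m ℂ
  isStarProjection : ∀ i, IsStarProjection (proj i)
  orthogonal : ∀ i j, i ≠ j → proj i * proj j = 0
  sum_eq_one : ∑ i, proj i = 1

/-- A projective measurement all of whose projections are one-dimensional. -/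
def ProjMeasurement.IsRankOne {m : Type} [Fintype m] [DecidableEq m] {ι : Type} [Fintype ι]
    (P : ProjMeasurement m ι) : Prop :=
  ∀ i, (P.proj i).rank = 1

/-- A response function for projective measurements: given a measurement (with outcomes labelled
by `Fin n`, for any `n`) and a value `x` of the hidden variable, a probability distribution on the
outcomes, depending measurably on `x`. -/
structure ResponseFunction (m : Type) [Fintype m] [DecidableEq m]
    (Λ : Type) [MeasurableSpace Λ] where
  prob : ∀ {n : ℕ}, ProjMeasurement m (Fin n) → Λ → Fin n → ℝ
  nonneg : ∀ {n : ℕ} (P : ProjMeasurement m (Fin n)) (x : Λ) (a : Fin n), 0 ≤ prob P x a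
  sum_eq_one : ∀ {n : ℕ} (P : ProjMeasurement m (Fin n)) (x : Λ), ∑ a, prob P x a = 1
  measurable : ∀ {n : ℕ} (P : ProjMeasurement m (Fin n)) (a : Fin n),
    Measurable fun x => prob P x a

/-- The hidden-variable distribution `π` with response functions `pA`, `pB` reproduces the
statistics of `ρ` for every pair of projective measurements. -/
def Reproduces {m n : Type} [Fintype m] [DecidableEq m] [Fintype n] [DecidableEq n]
    {Λ : Type} [MeasurableSpace Λ] (π : Measure Λ)
    (pA : ResponseFunction m Λ) (pB : ResponseFunction n Λ)
    (ρ : Matrix (m × n) (m × n) ℂ) : Prop :=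
  ∀ (k l : ℕ) (P : ProjMeasurement m (Fin k)) (Q : ProjMeasurement n (Fin l))
    (a : Fin k) (b : Fin l),
    (ρ * (P.proj a ⊗ₖ Q.proj b)).trace = ((∫ x, pA.prob P x a * pB.prob Q x b ∂π : ℝ) : ℂ)

/-- `ρ` admits a local hidden-variables model for projective measurements. -/
def AdmitsLocalModel {m n : Type} [Fintype m] [DecidableEq m] [Fintype n] [DecidableEq n]
    (ρ : Matrix (m × n) (m × n) ℂ) : Prop :=
  ∃ (Λ : Type) (_ : MeasurableSpace Λ) (π : Measure Λ) (_ : IsProbabilityMeasure π)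
    (pA : ResponseFunction m Λ) (pB : ResponseFunction n Λ), Reproduces π pA pB ρ

/-- The space of hidden variables: the unit sphere of `ℂ^d`. -/
abbrev HiddenVar (d : ℕ) : Type := Metric.sphere (0 : EuclideanSpace ℂ (Fin d)) 1

/-- The uniform distribution on the unit sphere of `ℂ^d`: normalised surface measure. -/
def uniformSphere (d : ℕ) : Measure (HiddenVar d) :=
  ((volume : Measure (EuclideanSpace ℂ (Fin d))).toSphere Set.univ)⁻¹ •
    (volume : Measure (EuclideanSpace ℂ (Fin d))).toSphere

/-- The action of a unitary of `ℂ^d` on the unit sphere. -/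
def unitaryAct {d : ℕ} (U : EuclideanSpace ℂ (Fin d) ≃ₗᵢ[ℂ] EuclideanSpace ℂ (Fin d))
    (x : HiddenVar d) : HiddenVar d :=
  ⟨U x, by simp⟩

/-- The Born weight `⟨x|A|x⟩` (real part; it is real for the Hermitian `A` used here). -/
def born {d : ℕ} (x : HiddenVar d) (A : Matrix (Fin d) (Fin d) ℂ) : ℝ :=
  (star (WithLp.ofLp x.1) ⬝ᵥ (A *ᵥ WithLp.ofLp x.1)).re

theorem born_nonneg {d : ℕ} (x : HiddenVar d) {A : Matrix (Fin d) (Fin d) ℂ}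
    (hA : IsStarProjection A) : 0 ≤ born x A := by
  have h : A = Aᴴ * A := by
    have h1 : Aᴴ = A := hA.isSelfAdjoint
    rw [h1]; exact hA.isIdempotentElem.symm
  have h2 : (Aᴴ * A).PosSemidef := Matrix.posSemidef_conjTranspose_mul_self A
  rw [← h] at h2
  exact (Complex.le_def.1 (h2.dotProduct_mulVec_nonneg (WithLp.ofLp x.1))).1

theorem born_one {d : ℕ} (x : HiddenVar d) : born x 1 = 1 := by
  have h : ‖x.1‖ = 1 := by simp
  rw [EuclideanSpace.norm_eq, Real.sqrt_eq_one] at h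
  unfold born
  rw [Matrix.one_mulVec, dotProduct, Complex.re_sum]
  refine Eq.trans ?_ h
  refine Finset.sum_congr rfl fun i _ => ?_
  simp [Complex.sq_norm, Complex.normSq_apply]

theorem born_sum {d : ℕ} {ι : Type} [Fintype ι] (x : HiddenVar d)
    (A : ι → Matrix (Fin d) (Fin d) ℂ) : born x (∑ i, A i) = ∑ i, born x (A i) := by
  unfold born
  rw [Matrix.sum_mulVec, dotProduct_sum, Complex.re_sum]

theorem measurable_born {d : ℕ} (A : Matrix (Fin d) (Fin d) ℂ) :
    Measurable fun x : HiddenVar d => born x A := by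
  apply Continuous.measurable
  unfold born
  simp only [dotProduct, Matrix.mulVec, Pi.star_apply]
  fun_prop

/-- Bob's response function: the Born rule `⟨x|Q_b|x⟩`. -/
def bornResponse (d : ℕ) : ResponseFunction (Fin d) (HiddenVar d) where
  prob Q x b := born x (Q.proj b)
  nonneg Q x b := born_nonneg x (Q.isStarProjection b)
  sum_eq_one Q x := by rw [← born_sum, Q.sum_eq_one, born_one]
  measurable Q b := measurable_born (Q.proj b)

/-- Alice's response functions. For one-dimensional projections she outputs the outcome `a` with
the smallest Born weight `⟨x|P_a|x⟩` (at ties between several minimisers the distribution over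
these minimisers is left arbitrary). For projections of arbitrary rank her response is the sum of
the responses to the members of some refinement into one-dimensional projections. -/
structure IsMinimumResponse {d : ℕ} (pA : ResponseFunction (Fin d) (HiddenVar d)) : Prop where
  eq_one : ∀ {n : ℕ} (P : ProjMeasurement (Fin d) (Fin n)), P.IsRankOne →
    ∀ (x : HiddenVar d) (a : Fin n),
      (∀ k, k ≠ a → born x (P.proj a) < born x (P.proj k)) → pA.prob P x a = 1
  eq_zero : ∀ {n : ℕ} (P : ProjMeasurement (Fin d) (Fin n)), P.IsRankOne →
    ∀ (x : HiddenVar d) (a : Fin n),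
      (∃ k, k ≠ a ∧ born x (P.proj k) < born x (P.proj a)) → pA.prob P x a = 0
  coarse : ∀ {n : ℕ} (P : ProjMeasurement (Fin d) (Fin n)),
    ∃ (R : ProjMeasurement (Fin d) (Fin d)) (c : Fin d → Fin n), R.IsRankOne ∧
      (∀ a, P.proj a = ∑ k with c k = a, R.proj k) ∧
      ∀ x a, pA.prob P x a = ∑ k with c k = a, pA.prob R x k

end

end WernerModel

open WernerModel

/-! Everything reduces to the second moments of the uniform vector `x`, restricted to the cell where
coordinate `a` has the smallest modulus: the averages of `conj (x i) * x j` over that cell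
(`minMoment`). Unitary invariance of the sphere measure rotates any rank-one measurement to the
standard basis. Sign flips of single coordinates then kill the off-diagonal moments, and coordinate
permutations leave only two diagonal values, one for `i = a` and one for `i ≠ a`.

Two sum rules fix these values. The moments with `i = a` sum over `a` to the mean of `min |x k|²`,
which is `1/d²`, so each is `1/d³`. All `d²` diagonal moments sum to `1`, so the others are `(1 -
1/d²) / (d(d-1)) = (d+1)/d³`. Hence the joint probability is `(d+1)/d³ · tr Q - 1/d² · tr (P Q)` for
rank-one `P`, which is exactly the trace of `wernerLocal d` against `P ⊗ Q`, because `tr (V (P ⊗ Q))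
= tr (P Q)`. Coarse-grained measurements follow by linearity.

The mean of the minimum comes from a Gaussian vector: the `|z i|²` are independent exponentials of
mean `1`, so their minimum has mean `1/d`, while `|z|²` has mean `d`. For functions homogeneous of
degree two the Gaussian mean is `d` times the spherical mean (`lintegral_uniformSphere_mul`).

Uniqueness of the Werner state holds because the commutant of all `U ⊗ U` is spanned by `1` and `V`
(`commutant_eq`), so the trace and `tr (V W)` determine `W`. Entanglement holds because `tr (V (A ⊗
B)) = tr (A B) ≥ 0` on product states, whereas the given value is negative. -/

namespace WernerModel

/-! ### Complex Gaussian vectors and the exponential law of squared moduli -/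

/-- The standard complex Gaussian law, with density `exp (-‖z‖²) / π`. -/
noncomputable def complexGaussian : Measure ℂ :=
  volume.withDensity fun z => ENNReal.ofReal (Real.exp (-‖z‖ ^ 2) / Real.pi)

theorem integral_Ioi_mul_exp_neg_sq (c : ℝ) :
    ∫ y in Set.Ioi c, y * Real.exp (-y ^ 2) = Real.exp (-c ^ 2) / 2 := by
  have hder : ∀ x ∈ Set.Ici c, HasDerivAt (fun y : ℝ => -Real.exp (-y ^ 2) / 2)
      (x * Real.exp (-x ^ 2)) x := by
    intro x _
    have h := ((((hasDerivAt_id x).pow 2).neg.exp).neg.div_const 2)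
    convert! h using 1
    simp
    ring
  have hint : IntegrableOn (fun y : ℝ => y * Real.exp (-y ^ 2)) (Set.Ioi c) := by
    have := integrable_mul_exp_neg_mul_sq (b := 1) one_pos
    simpa using this.integrableOn
  have hlim : Filter.Tendsto (fun y : ℝ => -Real.exp (-y ^ 2) / 2) Filter.atTop (nhds 0) := by
    have h1 : Filter.Tendsto (fun y : ℝ => Real.exp (-y ^ 2)) Filter.atTop (nhds 0) :=
      Real.tendsto_exp_neg_atTop_nhds_zero.comp (Filter.tendsto_pow_atTop two_ne_zero)
    simpa using (h1.neg.div_const 2)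
  rw [integral_Ioi_of_hasDerivAt_of_tendsto' hder hint hlim]
  ring

theorem integrable_gaussian_density :
    Integrable fun z : ℂ => Real.exp (-‖z‖ ^ 2) / Real.pi := by
  refine Integrable.div_const ?_ _
  rw [integrable_fun_norm_addHaar (volume : Measure ℂ) (f := fun y => Real.exp (-y ^ 2))]
  have := integrable_mul_exp_neg_mul_sq (b := 1) one_pos
  simpa using this.integrableOn

theorem complexGaussian_apply {s : Set ℂ} (hs : MeasurableSet s) :
    complexGaussian s =
      ENNReal.ofReal (∫ z, s.indicator (fun z => Real.exp (-‖z‖ ^ 2) / Real.pi) z) := by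
  rw [complexGaussian, withDensity_apply _ hs, integral_indicator hs,
    ofReal_integral_eq_lintegral_ofReal integrable_gaussian_density.integrableOn]
  exact Filter.Eventually.of_forall fun z => by positivity

/-- Polar coordinates in the plane turn the tail into the integral of `2 y exp (-y²)` beyond `√t`;
thus `|z|²` is exponential with mean one. -/
theorem complexGaussian_tail {t : ℝ} (ht : 0 ≤ t) :
    complexGaussian {z | t < ‖z‖ ^ 2} = ENNReal.ofReal (Real.exp (-t)) := by
  have hms : MeasurableSet {z : ℂ | t < ‖z‖ ^ 2} :=
    measurableSet_lt measurable_const (by fun_prop)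
  rw [complexGaussian_apply hms]
  congr 1
  have h1 := integral_fun_norm_addHaar (volume : Measure ℂ)
    ((Set.Ioi (Real.sqrt t)).indicator fun y => Real.exp (-y ^ 2) / Real.pi)
  have h2 : ∀ z : ℂ, {z : ℂ | t < ‖z‖ ^ 2}.indicator
      (fun z => Real.exp (-‖z‖ ^ 2) / Real.pi) z =
      (Set.Ioi (Real.sqrt t)).indicator (fun y => Real.exp (-y ^ 2) / Real.pi) ‖z‖ := by
    intro z
    simp only [Set.indicator, Set.mem_ofPred_eq, Set.mem_Ioi,
      Real.sqrt_lt ht (norm_nonneg z)]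
  simp_rw [h2, h1]
  have h3 : ∀ y : ℝ, y ^ (Module.finrank ℝ ℂ - 1) •
      (Set.Ioi (Real.sqrt t)).indicator (fun y => Real.exp (-y ^ 2) / Real.pi) y =
      (Set.Ioi (Real.sqrt t)).indicator (fun y => (y * Real.exp (-y ^ 2)) / Real.pi) y := by
    intro y
    by_cases hy : y ∈ Set.Ioi (Real.sqrt t) <;> simp [hy, mul_div_assoc]
  simp_rw [h3]
  rw [setIntegral_indicator measurableSet_Ioi, Set.inter_eq_self_of_subset_right
    (Set.Ioi_subset_Ioi (Real.sqrt_nonneg t)), integral_div, integral_Ioi_mul_exp_neg_sq,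
    Real.sq_sqrt ht]
  have h4 : (volume : Measure ℂ).real (Metric.ball 0 1) = Real.pi := by
    simp [Measure.real, Complex.volume_ball]
  rw [h4]
  simp
  field_simp

instance : IsProbabilityMeasure complexGaussian := by
  refine ⟨?_⟩
  have h : (Set.univ : Set ℂ) =ᵐ[complexGaussian] {z | 0 < ‖z‖ ^ 2} := by
    refine (withDensity_absolutelyContinuous volume _).ae_le ?_
    filter_upwards [compl_mem_ae_iff.2 (measure_singleton (0 : ℂ))] with z hz
    have : 0 < ‖z‖ ^ 2 := by have := norm_pos_iff.2 hz; positivity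
    exact propext ⟨fun _ => this, fun _ => trivial⟩
  rw [measure_congr h, complexGaussian_tail le_rfl]
  simp

/-- The law of `d` independent standard complex Gaussians. -/
noncomputable def gaussianVector (d : ℕ) : Measure (Fin d → ℂ) :=
  Measure.pi fun _ => complexGaussian

instance (d : ℕ) : IsProbabilityMeasure (gaussianVector d) := by
  unfold gaussianVector; infer_instance

theorem gaussianVector_eq_withDensity (d : ℕ) :
    gaussianVector d = volume.withDensity
      fun z => ENNReal.ofReal (∏ i, Real.exp (-‖z i‖ ^ 2) / Real.pi) := by
  refine Measure.pi_eq fun s hs => ?_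
  have hint : Integrable fun z : Fin d → ℂ => ∏ i, Real.exp (-‖z i‖ ^ 2) / Real.pi :=
    Integrable.fintype_prod fun _ => integrable_gaussian_density
  rw [withDensity_apply _ (MeasurableSet.univ_pi hs),
    ← ofReal_integral_eq_lintegral_ofReal hint.integrableOn
      (Filter.Eventually.of_forall fun z => by positivity),
    ← integral_indicator (MeasurableSet.univ_pi hs)]
  simp_rw [complexGaussian_apply (hs _)]
  rw [← ENNReal.ofReal_prod_of_nonneg fun i _ => integral_nonneg fun z =>
    Set.indicator_nonneg (fun z _ => by positivity) z]
  congr 1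
  rw [← integral_fintype_prod_volume_eq_prod]
  congr 1
  ext z
  by_cases hz : z ∈ Set.univ.pi s
  · rw [Set.indicator_of_mem hz]
    exact Finset.prod_congr rfl fun i _ =>
      (Set.indicator_of_mem (hz i trivial) fun z : ℂ => Real.exp (-‖z‖ ^ 2) / Real.pi).symm
  · rw [Set.indicator_of_notMem hz]
    simp only [Set.mem_pi, Set.mem_univ, true_imp_iff, not_forall] at hz
    obtain ⟨i, hi⟩ := hz
    exact (Finset.prod_eq_zero (Finset.mem_univ i) (Set.indicator_of_notMem hi _)).symm

theorem lintegral_exp_neg_mul {c : ℝ} (hc : 0 < c) :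
    ∫⁻ t in Set.Ioi (0 : ℝ), ENNReal.ofReal (Real.exp (-(c * t))) = ENNReal.ofReal (1 / c) := by
  rw [← ofReal_integral_eq_lintegral_ofReal]
  · have := integral_exp_mul_Ioi (a := -c) (by linarith) 0
    simp only [neg_mul] at this
    rw [this]; congr 1; simp
  · have := integrableOn_exp_mul_Ioi (a := -c) (by linarith) 0
    simp only [neg_mul] at this
    exact this
  · exact Filter.Eventually.of_forall fun z => by positivity

/-- By independence the minimum exceeds `t` with probability `exp (-t) ^ d`; integrating this tail
gives the mean. The hypothesis `hmin` characterises the minimum in the form the tail computation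
uses. -/
theorem lintegral_min_gaussianVector (d : ℕ) (hd : 0 < d) (m : (Fin d → ℂ) → ℝ)
    (hm : Measurable m) (hm0 : ∀ z, 0 ≤ m z)
    (hmin : ∀ z t, t < m z ↔ ∀ i, t < ‖z i‖ ^ 2) :
    ∫⁻ z, ENNReal.ofReal (m z) ∂gaussianVector d = ENNReal.ofReal (1 / d) := by
  rw [lintegral_eq_lintegral_meas_lt _ (Filter.Eventually.of_forall hm0) hm.aemeasurable,
    ← lintegral_exp_neg_mul (Nat.cast_pos.2 hd)]
  refine setLIntegral_congr_fun measurableSet_Ioi fun t ht => ?_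
  have hset : {z : Fin d → ℂ | t < m z} = Set.univ.pi fun _ => {w : ℂ | t < ‖w‖ ^ 2} := by
    ext z; simp [hmin]
  simp only [hset, gaussianVector, Measure.pi_pi, complexGaussian_tail (le_of_lt ht),
    Finset.prod_const, Finset.card_univ, Fintype.card_fin]
  rw [← ENNReal.ofReal_pow (Real.exp_nonneg _), ← Real.exp_nat_mul]
  congr 2
  ring

theorem lintegral_norm_sq_complexGaussian :
    ∫⁻ z, ENNReal.ofReal (‖z‖ ^ 2) ∂complexGaussian = 1 := by
  rw [lintegral_eq_lintegral_meas_lt _ (Filter.Eventually.of_forall fun z => by positivity)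
    (by fun_prop)]
  have := lintegral_exp_neg_mul one_pos
  simp only [one_mul, div_one, ENNReal.ofReal_one] at this
  rw [← this]
  exact setLIntegral_congr_fun measurableSet_Ioi fun t ht => complexGaussian_tail (le_of_lt ht)

theorem lintegral_norm_sq_gaussianVector (d : ℕ) :
    ∫⁻ z, ENNReal.ofReal (∑ i, ‖z i‖ ^ 2) ∂gaussianVector d = d := by
  simp_rw [ENNReal.ofReal_sum_of_nonneg fun (i : Fin d) _ => sq_nonneg _]
  rw [lintegral_finsetSum _ fun i _ => by fun_prop]
  have h : ∀ i : Fin d, ∫⁻ z, ENNReal.ofReal (‖z i‖ ^ 2) ∂gaussianVector d = 1 := by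
    intro i
    rw [← lintegral_norm_sq_complexGaussian]
    exact (measurePreserving_eval (fun _ : Fin d => complexGaussian) i).lintegral_comp
      (f := fun w : ℂ => ENNReal.ofReal (‖w‖ ^ 2)) (by fun_prop)
  rw [Finset.sum_congr rfl fun i _ => h i]
  simp

/-- Given one coordinate, equality of moduli confines the other, independent one to a circle, which
is Lebesgue null. -/
theorem gaussianVector_norm_ne {d : ℕ} {i j : Fin d} (hij : i ≠ j) :
    gaussianVector d {z | ‖z i‖ = ‖z j‖} = 0 := by
  have hind : ProbabilityTheory.iIndepFun (fun (i : Fin d) (z : Fin d → ℂ) => z i)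
      (gaussianVector d) :=
    ProbabilityTheory.iIndepFun_pi (X := fun _ => id) fun _ => aemeasurable_id
  have hprod := (ProbabilityTheory.indepFun_iff_map_prod_eq_prod_map_map
    (measurable_pi_apply i).aemeasurable (measurable_pi_apply j).aemeasurable).1
    (hind.indepFun hij)
  have hev : ∀ i : Fin d, (gaussianVector d).map (fun z => z i) = complexGaussian := fun i =>
    (measurePreserving_eval (fun _ : Fin d => complexGaussian) i).map_eq
  rw [hev, hev] at hprod
  have hms : MeasurableSet {p : ℂ × ℂ | ‖p.1‖ = ‖p.2‖} :=
    measurableSet_eq_fun (by fun_prop) (by fun_prop)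
  have h0 : (complexGaussian.prod complexGaussian) {p : ℂ × ℂ | ‖p.1‖ = ‖p.2‖} = 0 := by
    rw [Measure.measure_prod_null hms]
    refine Filter.Eventually.of_forall fun w => ?_
    refine withDensity_absolutelyContinuous volume _ ?_
    have : Prod.mk w ⁻¹' {p : ℂ × ℂ | ‖p.1‖ = ‖p.2‖} = Metric.sphere 0 ‖w‖ := by
      ext z; simp [eq_comm]
    rw [this]
    exact Measure.addHaar_sphere _ _ _
  rw [← hprod, Measure.map_apply (by fun_prop) hms] at h0
  exact h0

/-! ### Polar coordinates: from Gaussian averages to spherical averages -/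

/-- Uniqueness of Haar measure gives proportionality. The constant never has to be computed, since
it cancels after normalisation. -/
theorem exists_map_ofLp_volume (d : ℕ) : ∃ c : ENNReal, c ≠ 0 ∧ c ≠ ⊤ ∧
    (volume : Measure (EuclideanSpace ℂ (Fin d))).map WithLp.ofLp =
      c • (volume : Measure (Fin d → ℂ)) := by
  have h : ((volume : Measure (EuclideanSpace ℂ (Fin d))).map
      (PiLp.continuousLinearEquiv 2 ℝ fun _ : Fin d => ℂ)).IsAddHaarMeasure := inferInstance
  rw [PiLp.coe_continuousLinearEquiv] at h
  refine ⟨Measure.addHaarScalarFactor ((volume : Measure (EuclideanSpace ℂ (Fin d))).map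
      WithLp.ofLp) (volume : Measure (Fin d → ℂ)), ?_, ENNReal.coe_ne_top,
    Measure.isAddLeftInvariant_eq_smul _ _⟩
  exact ENNReal.coe_ne_zero.2 (Measure.addHaarScalarFactor_pos_of_isAddHaarMeasure _ _).ne'

/-- A function on `ℂ^d` that is homogeneous of degree two under positive real scalars. -/
def IsQuadraticCone {d : ℕ} (g : (Fin d → ℂ) → ENNReal) : Prop :=
  ∀ (r : ℝ) (z : Fin d → ℂ), 0 < r → g (r • z) = ENNReal.ofReal (r ^ 2) * g z

/-- Homogeneity makes the integrand a product of a function of the direction and a function of the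
radius, so `C` is the radial integral and does not depend on `g`. -/
theorem exists_lintegral_gaussian_eq {d : ℕ} (hd : 0 < d) : ∃ C : ENNReal,
    ∀ g : (Fin d → ℂ) → ENNReal, Measurable g → IsQuadraticCone g →
      ∫⁻ x : EuclideanSpace ℂ (Fin d), g x.ofLp * ENNReal.ofReal (Real.exp (-‖x‖ ^ 2)) =
        (∫⁻ x, g x.1.ofLp ∂(volume : Measure (EuclideanSpace ℂ (Fin d))).toSphere) * C := by
  refine ⟨∫⁻ r, ENNReal.ofReal (r.1 ^ 2 * Real.exp (-r.1 ^ 2)) ∂(Measure.volumeIoiPow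
      (Module.finrank ℝ (EuclideanSpace ℂ (Fin d)) - 1)), fun g hg hcone => ?_⟩
  have : Nonempty (Fin d) := ⟨⟨0, hd⟩⟩
  have hg' : Measurable fun x : HiddenVar d => g x.1.ofLp :=
    hg.comp ((WithLp.measurable_ofLp 2 _).comp measurable_subtype_coe)
  rw [← lintegral_prod_mul hg'.aemeasurable (by fun_prop),
    ← (Measure.measurePreserving_homeomorphUnitSphereProd
      (volume : Measure (EuclideanSpace ℂ (Fin d)))).lintegral_comp_emb
      (Homeomorph.measurableEmbedding _)]
  conv_lhs => rw [← restrict_compl_singleton (μ := volume) (0 : EuclideanSpace ℂ (Fin d)),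
    ← lintegral_subtype_comap (measurableSet_singleton _).compl]
  refine lintegral_congr fun x => ?_
  have hx : 0 < ‖x.1‖ := norm_pos_iff.2 x.2
  have h1 : g x.1.ofLp = ENNReal.ofReal (‖x.1‖ ^ 2) * g ((‖x.1‖⁻¹ • x.1).ofLp) := by
    rw [← hcone _ _ hx]
    congr 1
    rw [WithLp.ofLp_smul, smul_smul, mul_inv_cancel₀ hx.ne', one_smul]
  simp only [homeomorphUnitSphereProd_apply_fst_coe, homeomorphUnitSphereProd_apply_snd_coe]
  rw [h1, ENNReal.ofReal_mul (by positivity)]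
  ring

theorem exists_lintegral_gaussianVector_eq (d : ℕ) : ∃ C : ENNReal, C ≠ 0 ∧ C ≠ ⊤ ∧
    ∀ g : (Fin d → ℂ) → ENNReal, Measurable g →
      ∫⁻ x : EuclideanSpace ℂ (Fin d), g x.ofLp * ENNReal.ofReal (Real.exp (-‖x‖ ^ 2)) =
        C * ∫⁻ z, g z ∂gaussianVector d := by
  obtain ⟨c, hc0, hct, hc⟩ := exists_map_ofLp_volume d
  refine ⟨c * ENNReal.ofReal (Real.pi ^ d), mul_ne_zero hc0 ?_,
    ENNReal.mul_ne_top hct ENNReal.ofReal_ne_top, fun g hg => ?_⟩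
  · simpa using pow_pos Real.pi_pos d
  have h1 : ∀ x : EuclideanSpace ℂ (Fin d),
      Real.exp (-‖x‖ ^ 2) = Real.pi ^ d * ∏ i, Real.exp (-‖x.ofLp i‖ ^ 2) / Real.pi := by
    intro x
    rw [Finset.prod_div_distrib, ← Real.exp_sum, EuclideanSpace.norm_sq_eq, Finset.prod_const,
      Finset.sum_neg_distrib]
    simp
    field_simp
  have hmeas : Measurable fun z : Fin d → ℂ =>
      ENNReal.ofReal (∏ i, Real.exp (-‖z i‖ ^ 2) / Real.pi) := by fun_prop
  calc _ = ∫⁻ x : EuclideanSpace ℂ (Fin d), (fun z : Fin d → ℂ => ENNReal.ofReal (Real.pi ^ d) *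
        (ENNReal.ofReal (∏ i, Real.exp (-‖z i‖ ^ 2) / Real.pi) * g z)) x.ofLp := by
        refine lintegral_congr fun x => ?_
        rw [h1, ENNReal.ofReal_mul (by positivity)]
        ring
    _ = ∫⁻ z, ENNReal.ofReal (Real.pi ^ d) *
        (ENNReal.ofReal (∏ i, Real.exp (-‖z i‖ ^ 2) / Real.pi) * g z)
          ∂((volume : Measure (EuclideanSpace ℂ (Fin d))).map WithLp.ofLp) := by
        rw [lintegral_map (by fun_prop) (WithLp.measurable_ofLp 2 _)]
    _ = _ := by
        rw [hc, lintegral_smul_measure, lintegral_const_mul _ (by fun_prop),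
          gaussianVector_eq_withDensity, lintegral_withDensity_eq_lintegral_mul _ hmeas hg,
          smul_eq_mul, mul_assoc]
        rfl

/-! ### The uniform distribution on the sphere -/

section

variable {d : ℕ}

theorem toSphere_univ_ne_zero (hd : 0 < d) :
    (volume : Measure (EuclideanSpace ℂ (Fin d))).toSphere Set.univ ≠ 0 := by
  have : Nonempty (Fin d) := ⟨⟨0, hd⟩⟩
  exact Measure.measure_univ_ne_zero.2 (Measure.toSphere_ne_zero _)

theorem isProbabilityMeasure_uniformSphere (hd : 0 < d) :
    IsProbabilityMeasure (uniformSphere d) := by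
  refine ⟨?_⟩
  rw [uniformSphere, Measure.smul_apply, smul_eq_mul,
    ENNReal.inv_mul_cancel (toSphere_univ_ne_zero hd) (measure_ne_top _ _)]

theorem sum_norm_sq_hiddenVar (x : HiddenVar d) : ∑ i, ‖x.1.ofLp i‖ ^ 2 = 1 := by
  rw [← EuclideanSpace.norm_sq_eq]
  simp

theorem isQuadraticCone_sum_norm_sq :
    IsQuadraticCone fun z : Fin d → ℂ => ENNReal.ofReal (∑ i, ‖z i‖ ^ 2) := by
  intro r z hr
  rw [← ENNReal.ofReal_mul (by positivity), Finset.mul_sum]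
  simp [mul_pow]

/-- Averages of quadratically homogeneous functions over the sphere are Gaussian averages. -/
theorem lintegral_uniformSphere_mul (hd : 0 < d) {g : (Fin d → ℂ) → ENNReal}
    (hg : Measurable g) (hcone : IsQuadraticCone g) :
    (∫⁻ x, g x.1.ofLp ∂uniformSphere d) * d = ∫⁻ z, g z ∂gaussianVector d := by
  obtain ⟨C, hC⟩ := exists_lintegral_gaussian_eq hd
  obtain ⟨K, hK0, hKt, hK⟩ := exists_lintegral_gaussianVector_eq d
  have hq : Measurable fun z : Fin d → ℂ => ENNReal.ofReal (∑ i, ‖z i‖ ^ 2) := by fun_prop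
  -- The test function `|z|²` is `1` on the sphere and has Gaussian mean `d`; it fixes the ratio of
  -- the unknown constants `C` and `K`.
  have h1 := (hC _ hq isQuadraticCone_sum_norm_sq).symm.trans (hK _ hq)
  rw [lintegral_norm_sq_gaussianVector] at h1
  simp only [sum_norm_sq_hiddenVar, ENNReal.ofReal_one, lintegral_one] at h1
  have h2 := (hC g hg hcone).symm.trans (hK g hg)
  set S := (volume : Measure (EuclideanSpace ℂ (Fin d))).toSphere Set.univ with hS
  have hS0 : S ≠ 0 := toSphere_univ_ne_zero hd
  have hSt : S ≠ ⊤ := measure_ne_top _ _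
  rw [uniformSphere, lintegral_smul_measure, smul_eq_mul, ← hS]
  rw [← ENNReal.mul_right_inj hK0 hKt, ← h2]
  calc _ = S⁻¹ * (∫⁻ x, g x.1.ofLp ∂(volume : Measure (EuclideanSpace ℂ (Fin d))).toSphere)
        * (K * d) := by ring
    _ = (S⁻¹ * S) * ((∫⁻ x, g x.1.ofLp
        ∂(volume : Measure (EuclideanSpace ℂ (Fin d))).toSphere) * C) := by rw [← h1]; ring
    _ = _ := by rw [ENNReal.inv_mul_cancel hS0 hSt, one_mul]

theorem uniformSphere_norm_ne (hd : 0 < d) {i j : Fin d} (hij : i ≠ j) :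
    ∀ᵐ x ∂uniformSphere d, ‖x.1.ofLp i‖ ≠ ‖x.1.ofLp j‖ := by
  have hms : MeasurableSet {z : Fin d → ℂ | ‖z i‖ = ‖z j‖} :=
    measurableSet_eq_fun (by fun_prop) (by fun_prop)
  -- The factor `|z|²` makes the indicator of the tie set homogeneous of degree two without changing
  -- it on the sphere.
  set g : (Fin d → ℂ) → ENNReal := {z : Fin d → ℂ | ‖z i‖ = ‖z j‖}.indicator
    fun z => ENNReal.ofReal (∑ i, ‖z i‖ ^ 2) with hgdef
  have hg : Measurable g := Measurable.indicator (by fun_prop) hms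
  have hcone : IsQuadraticCone g := by
    intro r z hr
    by_cases hz : ‖z i‖ = ‖z j‖
    · have hz' : ‖(r • z) i‖ = ‖(r • z) j‖ := by simp [hz]
      rw [hgdef, Set.indicator_of_mem (by exact hz'), Set.indicator_of_mem (by exact hz)]
      exact isQuadraticCone_sum_norm_sq r z hr
    · have hz' : ¬ ‖(r • z) i‖ = ‖(r • z) j‖ := by simpa [hr.ne'] using hz
      rw [hgdef, Set.indicator_of_notMem (by exact hz'), Set.indicator_of_notMem (by exact hz),
        mul_zero]
  have h := lintegral_uniformSphere_mul hd hg hcone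
  have h0 : ∫⁻ z, g z ∂gaussianVector d = 0 := by
    rw [hgdef, lintegral_indicator hms]
    exact setLIntegral_measure_zero _ _ (gaussianVector_norm_ne hij)
  have hg' : Measurable fun x : HiddenVar d => g x.1.ofLp :=
    hg.comp ((WithLp.measurable_ofLp 2 _).comp measurable_subtype_coe)
  rw [h0, mul_eq_zero, or_iff_left (by simpa using hd.ne'), lintegral_eq_zero_iff hg'] at h
  filter_upwards [h] with x hx heq
  have : g x.1.ofLp = 1 := by
    rw [hgdef, Set.indicator_of_mem (by exact heq), sum_norm_sq_hiddenVar, ENNReal.ofReal_one]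
  rw [this] at hx
  exact one_ne_zero hx

theorem lintegral_min_uniformSphere (hd : 0 < d) (m : (Fin d → ℂ) → ℝ)
    (hm : Measurable m) (hmin : ∀ z t, t < m z ↔ ∀ i, t < ‖z i‖ ^ 2) :
    ∫⁻ x, ENNReal.ofReal (m x.1.ofLp) ∂uniformSphere d = ENNReal.ofReal (1 / d ^ 2) := by
  have hm0 : ∀ z, 0 ≤ m z := by
    intro z
    refine le_of_forall_lt fun t ht => (hmin z t).2 fun i => ht.trans_le (sq_nonneg _)
  have hcone : IsQuadraticCone fun z : Fin d → ℂ => ENNReal.ofReal (m z) := by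
    intro r z hr
    rw [← ENNReal.ofReal_mul (by positivity)]
    refine congrArg ENNReal.ofReal ?_
    refine eq_of_forall_lt_iff fun t => ?_
    rw [hmin, mul_comm, ← div_lt_iff₀ (by positivity), hmin]
    refine forall_congr' fun i => ?_
    rw [div_lt_iff₀ (by positivity)]
    simp [mul_pow, mul_comm]
  have h := lintegral_uniformSphere_mul hd (by fun_prop) hcone
  rw [lintegral_min_gaussianVector d hd m hm hm0 hmin] at h
  have hd' : (0 : ℝ) < d := Nat.cast_pos.2 hd
  rw [← ENNReal.mul_left_inj (c := (d : ENNReal)) (by simpa using hd.ne') (by simp), h,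
    ← ENNReal.ofReal_natCast, ← ENNReal.ofReal_mul (by positivity)]
  congr 1
  field_simp

theorem measurable_unitaryAct (U : EuclideanSpace ℂ (Fin d) ≃ₗᵢ[ℂ] EuclideanSpace ℂ (Fin d)) :
    Measurable (unitaryAct U) :=
  ((U.continuous.measurable).comp measurable_subtype_coe).subtype_mk

-- The surface measure of `s` is, up to a constant, the volume of the cone over `s`. Taking cones
-- commutes with `U`, and `U`, being a real linear isometry, preserves volume.
open scoped Pointwise in
theorem uniformSphere_map_unitaryAct
    (U : EuclideanSpace ℂ (Fin d) ≃ₗᵢ[ℂ] EuclideanSpace ℂ (Fin d)) :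
    (uniformSphere d).map (unitaryAct U) = uniformSphere d := by
  let U' : EuclideanSpace ℂ (Fin d) ≃ₗᵢ[ℝ] EuclideanSpace ℂ (Fin d) :=
    { U.toLinearEquiv.restrictScalars ℝ with norm_map' := U.norm_map }
  have hU : MeasurePreserving U volume volume := U'.measurePreserving
  rw [uniformSphere, Measure.map_smul]
  congr 1
  refine Measure.ext fun s hs => ?_
  have hs' := measurable_unitaryAct U hs
  rw [Measure.map_apply (measurable_unitaryAct U) hs, Measure.toSphere_apply' _ hs',
    Measure.toSphere_apply' _ hs]
  congr 1
  have : Set.Ioo (0 : ℝ) 1 • (Subtype.val '' (unitaryAct U ⁻¹' s)) =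
      U ⁻¹' (Set.Ioo (0 : ℝ) 1 • (Subtype.val '' s)) := by
    ext y
    simp only [Set.mem_smul, Set.mem_image, Set.mem_preimage]
    constructor
    · rintro ⟨r, hr, _, ⟨x, hx, rfl⟩, rfl⟩
      exact ⟨r, hr, _, ⟨_, hx, rfl⟩, (U'.map_smul r x.1).symm⟩
    · rintro ⟨r, hr, _, ⟨x, hx, rfl⟩, h⟩
      refine ⟨r, hr, _, ⟨unitaryAct U.symm x, ?_, rfl⟩, ?_⟩
      · simpa [unitaryAct] using hx
      · apply U.injective
        rw [← h]
        exact (U'.map_smul r _).trans (congrArg (r • ·) (U.apply_symm_apply x.1))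
  rw [this]
  exact hU.measure_preimage_equiv (f := U'.toMeasurableEquiv) _

end

/-! ### Projective measurements and orthonormal bases -/

variable {d : ℕ}

/-- The operator `|v⟩⟨v|`. -/
def ketBra (v : EuclideanSpace ℂ (Fin d)) : Matrix (Fin d) (Fin d) ℂ :=
  vecMulVec v.ofLp (star v.ofLp)

theorem star_dotProduct_eq_inner (v w : EuclideanSpace ℂ (Fin d)) :
    star v.ofLp ⬝ᵥ w.ofLp = inner ℂ v w := by
  rw [EuclideanSpace.inner_eq_star_dotProduct, dotProduct_comm]

theorem orthonormalBasis_star_dotProduct {ι : Type} [Fintype ι] [DecidableEq ι]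
    (r : OrthonormalBasis ι ℂ (EuclideanSpace ℂ (Fin d))) (i j : ι) :
    star (r i).ofLp ⬝ᵥ (r j).ofLp = if i = j then 1 else 0 := by
  rw [star_dotProduct_eq_inner, orthonormal_iff_ite.1 r.orthonormal]

theorem ketBra_mulVec (v w : EuclideanSpace ℂ (Fin d)) :
    ketBra v *ᵥ w.ofLp = inner ℂ v w • v.ofLp := by
  rw [ketBra, vecMulVec_mulVec, star_dotProduct_eq_inner]
  ext i
  simp [mul_comm]

theorem sum_ketBra {ι : Type} [Fintype ι]
    (r : OrthonormalBasis ι ℂ (EuclideanSpace ℂ (Fin d))) : ∑ i, ketBra (r i) = 1 := by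
  rw [ext_iff_mulVec]
  intro v
  obtain ⟨w, rfl⟩ : ∃ w : EuclideanSpace ℂ (Fin d), w.ofLp = v := ⟨WithLp.toLp 2 v, rfl⟩
  rw [sum_mulVec, one_mulVec]
  simp_rw [ketBra_mulVec]
  conv_rhs => rw [← r.sum_repr' w]
  simp

theorem isStarProjection_ketBra {v : EuclideanSpace ℂ (Fin d)} (hv : ‖v‖ = 1) :
    IsStarProjection (ketBra v) := by
  refine ⟨?_, ?_⟩
  · rw [IsIdempotentElem, ketBra, vecMulVec_mul_vecMulVec, star_dotProduct_eq_inner,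
      inner_self_eq_norm_sq_to_K, hv]
    simp
  · rw [IsSelfAdjoint, star_eq_conjTranspose, ketBra, conjTranspose_vecMulVec, star_star]

theorem rank_eq_trace {P : Matrix (Fin d) (Fin d) ℂ} (hP : IsIdempotentElem P) :
    P.trace = (P.rank : ℂ) := by
  have h : IsIdempotentElem (toLin' P) := by
    rw [IsIdempotentElem, Module.End.mul_eq_comp, ← toLin'_mul, hP]
  rw [← trace_toLin'_eq, (LinearMap.IsIdempotentElem.isProj_range _ h).trace]
  rfl

theorem trace_ketBra_mul (v : EuclideanSpace ℂ (Fin d)) (Q : Matrix (Fin d) (Fin d) ℂ) :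
    (ketBra v * Q).trace = star v.ofLp ⬝ᵥ (Q *ᵥ v.ofLp) := by
  rw [trace_mul_comm, ketBra, mul_vecMulVec, trace_vecMulVec, dotProduct_comm]

theorem trace_eq_sum_basis {ι : Type} [Fintype ι]
    (r : OrthonormalBasis ι ℂ (EuclideanSpace ℂ (Fin d))) (Q : Matrix (Fin d) (Fin d) ℂ) :
    Q.trace = ∑ i, star (r i).ofLp ⬝ᵥ (Q *ᵥ (r i).ofLp) := by
  conv_lhs => rw [← one_mul Q, ← sum_ketBra r, Finset.sum_mul, trace_sum]
  exact Finset.sum_congr rfl fun i _ => trace_ketBra_mul _ _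

theorem rank_ketBra {v : EuclideanSpace ℂ (Fin d)} (hv : ‖v‖ = 1) : (ketBra v).rank = 1 := by
  have h := rank_eq_trace (isStarProjection_ketBra hv).isIdempotentElem
  rw [ketBra, trace_vecMulVec, dotProduct_comm, star_dotProduct_eq_inner,
    inner_self_eq_norm_sq_to_K, hv] at h
  rw [ketBra]
  have h1 : ((vecMulVec v.ofLp (star v.ofLp)).rank : ℂ) = 1 := h.symm.trans (by simp)
  exact_mod_cast h1

theorem born_ketBra (x : HiddenVar d) (v : EuclideanSpace ℂ (Fin d)) :
    born x (ketBra v) = ‖inner ℂ v x.1‖ ^ 2 := by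
  rw [born, ketBra_mulVec, dotProduct_smul, star_dotProduct_eq_inner, smul_eq_mul,
    ← inner_conj_symm x.1 v, Complex.mul_conj, Complex.normSq_eq_norm_sq]
  norm_cast

/-- The measurement in an orthonormal basis. -/
noncomputable def basisMeasurement {ι : Type} [Fintype ι] [DecidableEq ι]
    (r : OrthonormalBasis ι ℂ (EuclideanSpace ℂ (Fin d))) : ProjMeasurement (Fin d) ι where
  proj i := ketBra (r i)
  isStarProjection i := isStarProjection_ketBra (r.orthonormal.1 i)
  orthogonal i j hij := by
    rw [ketBra, ketBra, vecMulVec_mul_vecMulVec, orthonormalBasis_star_dotProduct, if_neg hij,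
      zero_smul, vecMulVec_zero]
  sum_eq_one := sum_ketBra r

theorem isRankOne_basisMeasurement {ι : Type} [Fintype ι] [DecidableEq ι]
    (r : OrthonormalBasis ι ℂ (EuclideanSpace ℂ (Fin d))) : (basisMeasurement r).IsRankOne :=
  fun i => rank_ketBra (r.orthonormal.1 i)

theorem ProjMeasurement.exists_basis {n : ℕ} (P : ProjMeasurement (Fin d) (Fin n)) :
    ∃ (r : OrthonormalBasis (Fin d) ℂ (EuclideanSpace ℂ (Fin d))) (c : Fin d → Fin n),
      ∀ a, P.proj a = ∑ k with c k = a, ketBra (r k) := by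
  -- Weighting the projections by their distinct labels gives one Hermitian matrix. Each of its
  -- eigenvectors lies in the range of exactly one projection, so an eigenbasis refines the whole
  -- measurement.
  set A : Matrix (Fin d) (Fin d) ℂ := ∑ i : Fin n, ((i : ℕ) : ℂ) • P.proj i with hA
  have hherm : A.IsHermitian := by
    rw [IsHermitian, hA, conjTranspose_sum]
    refine Finset.sum_congr rfl fun i _ => ?_
    have h1 : (P.proj i)ᴴ = P.proj i := (P.isStarProjection i).isSelfAdjoint
    rw [conjTranspose_smul, h1]
    simp
  have hPA : ∀ a, P.proj a * A = ((a : ℕ) : ℂ) • P.proj a := by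
    intro a
    rw [hA, Finset.mul_sum, Finset.sum_eq_single a]
    · rw [Matrix.mul_smul, (P.isStarProjection a).isIdempotentElem.eq]
    · intro b _ hb
      rw [Matrix.mul_smul, P.orthogonal a b hb.symm, smul_zero]
    · simp
  set r := hherm.eigenvectorBasis
  have hr : ∀ k, A *ᵥ (r k).ofLp = (hherm.eigenvalues k : ℂ) • (r k).ofLp := fun k =>
    hherm.mulVec_eigenvectorBasis k
  have hsum : ∀ k, ∑ a, P.proj a *ᵥ (r k).ofLp = (r k).ofLp := fun k => by
    rw [← sum_mulVec, P.sum_eq_one, one_mulVec]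
  have heig : ∀ k a, P.proj a *ᵥ (r k).ofLp ≠ 0 → (hherm.eigenvalues k : ℂ) = ((a : ℕ) : ℂ) := by
    intro k a hne
    have h := congrArg (P.proj a *ᵥ ·) (hr k)
    simp only [mulVec_mulVec, hPA, mulVec_smul, smul_mulVec] at h
    exact (smul_left_injective ℂ hne h).symm
  have hex : ∀ k, ∃ a, P.proj a *ᵥ (r k).ofLp ≠ 0 := by
    intro k
    by_contra! h
    have h0 := hsum k
    rw [Finset.sum_eq_zero fun a _ => h a] at h0
    exact r.orthonormal.ne_zero k (WithLp.ofLp_injective 2 h0.symm)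
  choose c hc using hex
  have hzero : ∀ k a, c k ≠ a → P.proj a *ᵥ (r k).ofLp = 0 := by
    intro k a hne
    by_contra h
    have h1 := (heig k _ (hc k)).symm.trans (heig k a h)
    exact hne (Fin.ext (by exact_mod_cast h1))
  have hone : ∀ k, P.proj (c k) *ᵥ (r k).ofLp = (r k).ofLp := by
    intro k
    conv_rhs => rw [← hsum k]
    exact (Finset.sum_eq_single _ (fun a _ ha => hzero k a ha.symm) (by simp)).symm
  refine ⟨r, c, fun a => ?_⟩
  conv_lhs => rw [← mul_one (P.proj a), ← sum_ketBra r, Finset.mul_sum]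
  rw [Finset.sum_filter]
  refine Finset.sum_congr rfl fun k _ => ?_
  rw [ketBra, mul_vecMulVec]
  split_ifs with h
  · rw [← h, hone]
  · rw [hzero k a h, zero_vecMulVec]

theorem ProjMeasurement.IsRankOne.eq_dim {n : ℕ} {P : ProjMeasurement (Fin d) (Fin n)}
    (hP : P.IsRankOne) : n = d := by
  have h := congrArg trace P.sum_eq_one
  rw [trace_sum, trace_one, Finset.sum_congr rfl fun i _ =>
    (rank_eq_trace (P.isStarProjection i).isIdempotentElem).trans (by rw [hP i])] at h
  simpa using h

/-- No projection is zero, so the assignment of basis vectors to the `d` outcomes is surjective,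
hence bijective. -/
theorem ProjMeasurement.IsRankOne.exists_basis {P : ProjMeasurement (Fin d) (Fin d)}
    (hP : P.IsRankOne) : ∃ r : OrthonormalBasis (Fin d) ℂ (EuclideanSpace ℂ (Fin d)),
      ∀ a, P.proj a = ketBra (r a) := by
  obtain ⟨r, c, h⟩ := P.exists_basis
  have hsurj : Function.Surjective c := by
    intro a
    by_contra! hne
    have h0 : P.proj a = 0 := by
      rw [h a, Finset.filter_false_of_mem fun k _ => hne k, Finset.sum_empty]
    have h1 := hP a
    rw [h0, rank_zero] at h1
    exact zero_ne_one h1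
  let e := Equiv.ofBijective c (Finite.surjective_iff_bijective.1 hsurj)
  refine ⟨r.reindex e, fun a => ?_⟩
  rw [h a, OrthonormalBasis.reindex_apply]
  refine (Finset.sum_eq_single_of_mem (e.symm a) ?_ ?_)
  · exact Finset.mem_filter.2 ⟨Finset.mem_univ _, e.apply_symm_apply a⟩
  · intro k hk hne
    exact absurd (e.injective (((Finset.mem_filter.1 hk).2).trans
      (e.apply_symm_apply a).symm)) hne

theorem born_eq_sum_basis {ι : Type} [Fintype ι]
    (r : OrthonormalBasis ι ℂ (EuclideanSpace ℂ (Fin d)))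
    (x : HiddenVar d) (Q : Matrix (Fin d) (Fin d) ℂ) :
    born x Q = (∑ i, ∑ j, (star (r i).ofLp ⬝ᵥ (Q *ᵥ (r j).ofLp)) *
      (star ((r.repr x.1).ofLp i) * (r.repr x.1).ofLp j)).re := by
  have hx : x.1.ofLp = ∑ j, (r.repr x.1).ofLp j • (r j).ofLp := by
    conv_lhs => rw [← r.sum_repr x.1]
    simp
  rw [born]
  conv_lhs => rw [hx]
  rw [mulVec_sum, star_sum, sum_dotProduct]
  congr 1
  refine Finset.sum_congr rfl fun i _ => ?_
  rw [dotProduct_sum]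
  refine Finset.sum_congr rfl fun j _ => ?_
  rw [mulVec_smul, dotProduct_smul, star_smul, smul_dotProduct, smul_eq_mul, smul_eq_mul]
  ring

/-! ### Second moments restricted to the cell of a minimal coordinate -/

/-- The indicator of the set where the `a`-th coordinate has minimal modulus. -/
noncomputable def minIndicator (a : Fin d) (z : Fin d → ℂ) : ℝ :=
  {z : Fin d → ℂ | ∀ k, ‖z a‖ ≤ ‖z k‖}.indicator 1 z

theorem minIndicator_nonneg (a : Fin d) (z : Fin d → ℂ) : 0 ≤ minIndicator a z :=
  Set.indicator_nonneg (fun _ _ => zero_le_one) z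

theorem minIndicator_le_one (a : Fin d) (z : Fin d → ℂ) : minIndicator a z ≤ 1 :=
  Set.indicator_le_self' (fun _ _ => zero_le_one) z

theorem measurable_minIndicator (a : Fin d) : Measurable (minIndicator a) := by
  refine measurable_one.indicator ?_
  have : {z : Fin d → ℂ | ∀ k, ‖z a‖ ≤ ‖z k‖} = ⋂ k, {z | ‖z a‖ ≤ ‖z k‖} := by
    ext z; simp
  rw [this]
  exact MeasurableSet.iInter fun k => measurableSet_le (by fun_prop) (by fun_prop)

theorem minIndicator_congr {a b : Fin d} {z w : Fin d → ℂ} (σ : Equiv.Perm (Fin d))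
    (hσ : σ a = b) (h : ∀ k, ‖z k‖ = ‖w (σ k)‖) : minIndicator a z = minIndicator b w := by
  subst hσ
  have : (∀ k, ‖z a‖ ≤ ‖z k‖) ↔ ∀ k, ‖w (σ a)‖ ≤ ‖w k‖ := by
    simp only [h]
    exact ⟨fun H k => by simpa using H (σ.symm k), fun H k => H _⟩
  simp only [minIndicator, Set.indicator, Set.mem_ofPred_eq, this, Pi.one_apply]

theorem measurable_ofLp_hiddenVar : Measurable fun x : HiddenVar d => x.1.ofLp :=
  (WithLp.measurable_ofLp 2 _).comp measurable_subtype_coe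

theorem integral_uniformSphere_unitary {F : Type} [NormedAddCommGroup F] [NormedSpace ℝ F]
    (U : EuclideanSpace ℂ (Fin d) ≃ₗᵢ[ℂ] EuclideanSpace ℂ (Fin d)) (f : HiddenVar d → F) :
    ∫ x, f (unitaryAct U x) ∂uniformSphere d = ∫ x, f x ∂uniformSphere d := by
  let e : HiddenVar d ≃ᵐ HiddenVar d :=
    { toFun := unitaryAct U
      invFun := unitaryAct U.symm
      left_inv := fun x => Subtype.ext (U.symm_apply_apply x.1)
      right_inv := fun x => Subtype.ext (U.apply_symm_apply x.1)
      measurable_toFun := measurable_unitaryAct U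
      measurable_invFun := measurable_unitaryAct U.symm }
  have h : (uniformSphere d).map e = uniformSphere d := uniformSphere_map_unitaryAct U
  conv_rhs => rw [← h]
  exact (integral_map_equiv e f).symm

theorem norm_coord_le_one (x : HiddenVar d) (i : Fin d) : ‖x.1.ofLp i‖ ≤ 1 := by
  have h := PiLp.norm_apply_le x.1 i
  simpa using h

/-- The matrix elements of the second moment restricted to where coordinate `a` is minimal. -/
noncomputable def minMoment (a i j : Fin d) : ℂ :=
  ∫ x : HiddenVar d, (minIndicator a x.1.ofLp : ℂ) * (star (x.1.ofLp i) * x.1.ofLp j)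
    ∂uniformSphere d

theorem integrable_uniformSphere_of_bound (hd : 0 < d) {F : Type} [NormedAddCommGroup F]
    [MeasurableSpace F] [BorelSpace F] [SecondCountableTopology F]
    {f : HiddenVar d → F} (hf : Measurable f) (C : ℝ) (hC : ∀ x, ‖f x‖ ≤ C) :
    Integrable f (uniformSphere d) := by
  have := isProbabilityMeasure_uniformSphere hd
  exact Integrable.of_bound hf.aestronglyMeasurable C (Filter.Eventually.of_forall hC)

theorem measurable_minMoment_integrand (a i j : Fin d) : Measurable fun x : HiddenVar d =>
    (minIndicator a x.1.ofLp : ℂ) * (star (x.1.ofLp i) * x.1.ofLp j) := by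
  have h := (measurable_minIndicator a).comp (measurable_ofLp_hiddenVar (d := d))
  have h1 : ∀ i, Measurable fun x : HiddenVar d => x.1.ofLp i := fun i =>
    (measurable_pi_apply i).comp measurable_ofLp_hiddenVar
  exact (Complex.measurable_ofReal.comp h).mul ((continuous_star.measurable.comp (h1 i)).mul (h1 j))

theorem integrable_minMoment (hd : 0 < d) (a i j : Fin d) : Integrable (fun x : HiddenVar d =>
    (minIndicator a x.1.ofLp : ℂ) * (star (x.1.ofLp i) * x.1.ofLp j)) (uniformSphere d) := by
  refine integrable_uniformSphere_of_bound hd (measurable_minMoment_integrand a i j) 1 fun x => ?_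
  rw [norm_mul, norm_mul, norm_star, Complex.norm_real, Real.norm_of_nonneg
    (minIndicator_nonneg _ _)]
  exact mul_le_one₀ (minIndicator_le_one _ _) (by positivity)
    (mul_le_one₀ (norm_coord_le_one x i) (norm_nonneg _) (norm_coord_le_one x j))

/-- Negating coordinate `i` alone preserves the measure and all moduli but reverses the sign of the
integrand. -/
theorem minMoment_off_diag (a : Fin d) {i j : Fin d} (hij : i ≠ j) : minMoment a i j = 0 := by
  let U : EuclideanSpace ℂ (Fin d) ≃ₗᵢ[ℂ] EuclideanSpace ℂ (Fin d) :=
    LinearIsometryEquiv.piLpCongrRight 2 fun k =>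
      if k = i then LinearIsometryEquiv.neg ℂ else LinearIsometryEquiv.refl ℂ ℂ
  have hU : ∀ (x : HiddenVar d) k,
      (unitaryAct U x).1.ofLp k = if k = i then -x.1.ofLp k else x.1.ofLp k := by
    intro x k
    simp only [unitaryAct, U, LinearIsometryEquiv.piLpCongrRight_apply]
    split_ifs <;> simp
  have h := integral_uniformSphere_unitary U fun x : HiddenVar d =>
    (minIndicator a x.1.ofLp : ℂ) * (star (x.1.ofLp i) * x.1.ofLp j)
  have hmin : ∀ x : HiddenVar d,
      minIndicator a (unitaryAct U x).1.ofLp = minIndicator a x.1.ofLp := fun x =>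
    minIndicator_congr (Equiv.refl _) rfl fun k => by
      rw [hU]; split_ifs <;> simp
  simp only [hmin, hU, ↓reduceIte, if_neg hij.symm, star_neg, neg_mul, mul_neg] at h
  rw [integral_neg] at h
  exact self_eq_neg.1 h.symm

theorem minMoment_perm (σ : Equiv.Perm (Fin d)) (a i : Fin d) :
    minMoment (σ a) (σ i) (σ i) = minMoment a i i := by
  let U : EuclideanSpace ℂ (Fin d) ≃ₗᵢ[ℂ] EuclideanSpace ℂ (Fin d) :=
    LinearIsometryEquiv.piLpCongrLeft 2 ℂ ℂ σ.symm
  have hU : ∀ (x : HiddenVar d) k, (unitaryAct U x).1.ofLp k = x.1.ofLp (σ k) := by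
    intro x k
    simp [unitaryAct, U, LinearIsometryEquiv.piLpCongrLeft_apply, Equiv.piCongrLeft']
  have h := integral_uniformSphere_unitary U fun x : HiddenVar d =>
    (minIndicator a x.1.ofLp : ℂ) * (star (x.1.ofLp i) * x.1.ofLp i)
  have hmin : ∀ x : HiddenVar d,
      minIndicator a (unitaryAct U x).1.ofLp = minIndicator (σ a) x.1.ofLp := fun x =>
    minIndicator_congr σ rfl fun k => by rw [hU]
  simp_rw [hmin, hU] at h
  exact h

theorem ae_existsUnique_min (hd : 0 < d) :
    ∀ᵐ x ∂uniformSphere d, ∃! a, ∀ k, ‖x.1.ofLp a‖ ≤ ‖x.1.ofLp k‖ := by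
  have h : ∀ᵐ x ∂uniformSphere d, ∀ i j : Fin d, i ≠ j → ‖x.1.ofLp i‖ ≠ ‖x.1.ofLp j‖ := by
    simp_rw [ae_all_iff]
    exact fun i j hij => uniformSphere_norm_ne hd hij
  have : Nonempty (Fin d) := ⟨⟨0, hd⟩⟩
  filter_upwards [h] with x hx
  obtain ⟨a, ha⟩ := Finite.exists_min fun k => ‖x.1.ofLp k‖
  refine ⟨a, ha, fun b hb => ?_⟩
  by_contra hne
  exact hx b a hne (le_antisymm (hb a) (ha b))

theorem ae_sum_minIndicator_mul (hd : 0 < d) : ∀ᵐ x ∂uniformSphere d, ∃ a : Fin d,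
    (∀ k, ‖x.1.ofLp a‖ ≤ ‖x.1.ofLp k‖) ∧
    ∀ f : Fin d → ℂ, ∑ b, (minIndicator b x.1.ofLp : ℂ) * f b = f a := by
  filter_upwards [ae_existsUnique_min hd] with x hx
  obtain ⟨a, ha, hu⟩ := hx
  refine ⟨a, ha, fun f => ?_⟩
  rw [Finset.sum_eq_single a]
  · rw [minIndicator, Set.indicator_of_mem (by exact ha)]; simp
  · intro b _ hb
    rw [minIndicator, Set.indicator_of_notMem (by exact fun h => hb (hu b h))]; simp
  · simp

theorem sum_minMoment_diag (hd : 0 < d) : ∑ a, ∑ i, minMoment (d := d) a i i = 1 := by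
  have := isProbabilityMeasure_uniformSphere hd
  have h1 : ∀ x : HiddenVar d, ∑ i, star (x.1.ofLp i) * x.1.ofLp i = 1 := by
    intro x
    have h := sum_norm_sq_hiddenVar x
    have h2 : ∀ i, star (x.1.ofLp i) * x.1.ofLp i = ((‖x.1.ofLp i‖ ^ 2 : ℝ) : ℂ) := by
      intro i
      rw [mul_comm]
      simpa [Complex.normSq_eq_norm_sq] using Complex.mul_conj (x.1.ofLp i)
    simp_rw [h2]
    exact_mod_cast h
  calc _ = ∑ a, ∫ x : HiddenVar d, (minIndicator a x.1.ofLp : ℂ) * 1 ∂uniformSphere d := by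
        refine Finset.sum_congr rfl fun a _ => ?_
        simp_rw [minMoment]
        rw [← integral_finsetSum _ fun i _ => integrable_minMoment hd a i i]
        refine integral_congr_ae (Filter.Eventually.of_forall fun x => ?_)
        simp only [← Finset.mul_sum]
        rw [h1]
    _ = ∫ x : HiddenVar d, ∑ a, (minIndicator a x.1.ofLp : ℂ) * 1 ∂uniformSphere d := by
        rw [integral_finsetSum]
        intro a _
        have := integrable_finsetSum Finset.univ fun i _ => integrable_minMoment hd a i i
        refine this.congr (Filter.Eventually.of_forall fun x => ?_)
        simp only [← Finset.mul_sum]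
        rw [h1]
    _ = ∫ x : HiddenVar d, 1 ∂uniformSphere d := by
        refine integral_congr_ae ?_
        filter_upwards [ae_sum_minIndicator_mul hd] with x ⟨a, _, hx⟩
        exact hx fun _ => 1
    _ = 1 := by simp

/-- On the cell of `a` the integrand is `|x a|²`, the minimum itself. The cells cover the sphere
with almost no overlap, so the sum is the mean of the minimum. -/
theorem sum_minMoment_self (hd : 0 < d) :
    ∑ a, minMoment (d := d) a a a = ((1 / d ^ 2 : ℝ) : ℂ) := by
  have hne : (Finset.univ : Finset (Fin d)).Nonempty := ⟨⟨0, hd⟩, Finset.mem_univ _⟩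
  let m : (Fin d → ℂ) → ℝ := fun z => Finset.univ.inf' hne fun i => ‖z i‖ ^ 2
  have hm : Measurable m := by
    have : Continuous m := Continuous.finset_inf'_apply hne fun i _ => by fun_prop
    exact this.measurable
  have hmin : ∀ z t, t < m z ↔ ∀ i, t < ‖z i‖ ^ 2 := by
    intro z t
    simp [m, Finset.lt_inf'_iff]
  have hm0 : ∀ z, 0 ≤ m z := fun z => Finset.le_inf' hne _ fun i _ => sq_nonneg _
  have hmsph : Measurable fun x : HiddenVar d => m x.1.ofLp := hm.comp measurable_ofLp_hiddenVar
  have h := lintegral_min_uniformSphere hd m hm hmin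
  have hint : ∫ x : HiddenVar d, m x.1.ofLp ∂uniformSphere d = 1 / d ^ 2 := by
    rw [integral_eq_lintegral_of_nonneg_ae (Filter.Eventually.of_forall fun x => hm0 _)
      hmsph.aestronglyMeasurable, h, ENNReal.toReal_ofReal (by positivity)]
  rw [← hint, ← integral_complex_ofReal]
  simp_rw [minMoment]
  rw [← integral_finsetSum _ fun a _ => integrable_minMoment hd a a a]
  refine integral_congr_ae ?_
  filter_upwards [ae_sum_minIndicator_mul hd] with x ⟨a, ha, hx⟩
  rw [hx fun a => star (x.1.ofLp a) * x.1.ofLp a]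
  have h1 : m x.1.ofLp = ‖x.1.ofLp a‖ ^ 2 :=
    le_antisymm (Finset.inf'_le _ (Finset.mem_univ a))
      (Finset.le_inf' hne _ fun k _ => pow_le_pow_left₀ (norm_nonneg _) (ha k) 2)
  rw [h1, mul_comm]
  simpa [Complex.normSq_eq_norm_sq] using Complex.mul_conj (x.1.ofLp a)

theorem minMoment_self (hd : 0 < d) (a : Fin d) : minMoment a a a = 1 / (d : ℂ) ^ 3 := by
  have h := sum_minMoment_self hd
  have h1 : ∀ b, minMoment b b b = minMoment a a a := fun b => by
    simpa using minMoment_perm (Equiv.swap a b) a a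
  have hd' : (d : ℂ) ≠ 0 := by exact_mod_cast hd.ne'
  simp only [h1, Finset.sum_const, Finset.card_univ, Fintype.card_fin, nsmul_eq_mul] at h
  push_cast at h
  field_simp at h ⊢
  linear_combination h

theorem minMoment_diag (hd : 2 ≤ d) {a i : Fin d} (hi : i ≠ a) :
    minMoment a i i = ((d : ℂ) + 1) / (d : ℂ) ^ 3 := by
  have hd0 : 0 < d := by omega
  have h := sum_minMoment_diag hd0
  have h1 : ∀ b j : Fin d, j ≠ b → minMoment b j j = minMoment a i i := by
    intro b j hj
    have hs : (Equiv.swap a b) j ≠ a := by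
      intro h
      rw [Equiv.swap_apply_eq_iff, Equiv.swap_apply_left] at h
      exact hj h
    -- The first transposition sends `b` to `a`; the second moves the image of `j` to `i` and fixes
    -- `a`.
    rw [← minMoment_perm (Equiv.swap (Equiv.swap a b j) i * Equiv.swap a b) b j]
    rw [Equiv.Perm.mul_apply, Equiv.Perm.mul_apply, Equiv.swap_apply_right,
      Equiv.swap_apply_left, Equiv.swap_apply_of_ne_of_ne hs.symm hi.symm]
  have h2 : ∀ b : Fin d, ∑ j, minMoment b j j =
      1 / (d : ℂ) ^ 3 + ((d : ℂ) - 1) * minMoment a i i := by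
    intro b
    rw [← Finset.add_sum_erase _ _ (Finset.mem_univ b), minMoment_self hd0,
      Finset.sum_congr rfl fun j hj => h1 b j (Finset.ne_of_mem_erase hj), Finset.sum_const,
      Finset.card_erase_of_mem (Finset.mem_univ b), Finset.card_univ, Fintype.card_fin,
      nsmul_eq_mul, Nat.cast_sub (by omega), Nat.cast_one]
  simp only [h2, Finset.sum_const, Finset.card_univ, Fintype.card_fin, nsmul_eq_mul] at h
  have hd' : (d : ℂ) ≠ 0 := by exact_mod_cast hd0.ne'
  have hd1 : (d : ℂ) - 1 ≠ 0 := by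
    rw [sub_ne_zero]
    exact_mod_cast (by omega : d ≠ 1)
  have hd2 : (d : ℂ) * ((d : ℂ) - 1) ≠ 0 := mul_ne_zero hd' hd1
  apply mul_left_cancel₀ hd2
  -- Of the `d²` diagonal moments, `d` equal `1/d³` and the remaining `d(d-1)` are equal to one
  -- another.
  have h3 : (d : ℂ) * ((d : ℂ) - 1) * minMoment a i i = 1 - (d : ℂ) * (1 / (d : ℂ) ^ 3) := by
    linear_combination h
  rw [h3]
  field_simp
  ring

theorem integral_minIndicator_mul_born (hd : 2 ≤ d)
    (r : OrthonormalBasis (Fin d) ℂ (EuclideanSpace ℂ (Fin d))) (a : Fin d)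
    (Q : Matrix (Fin d) (Fin d) ℂ) :
    ∫ x : HiddenVar d, minIndicator a (r.repr x.1).ofLp * born x Q ∂uniformSphere d =
      (((d : ℂ) + 1) / (d : ℂ) ^ 3 * Q.trace - 1 / (d : ℂ) ^ 2 * (ketBra (r a) * Q).trace).re := by
  have hd0 : 0 < d := by omega
  set q : Fin d → Fin d → ℂ := fun i j => star (r i).ofLp ⬝ᵥ (Q *ᵥ (r j).ofLp) with hq
  have hint : ∀ i j, Integrable (fun y : HiddenVar d =>
      q i j * ((minIndicator a y.1.ofLp : ℂ) * (star (y.1.ofLp i) * y.1.ofLp j)))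
      (uniformSphere d) := fun i j => (integrable_minMoment hd0 a i j).const_mul _
  have h1 : ∀ x : HiddenVar d, minIndicator a (r.repr x.1).ofLp * born x Q =
      (∑ i, ∑ j, q i j * ((minIndicator a (unitaryAct r.repr x).1.ofLp : ℂ) *
        (star ((unitaryAct r.repr x).1.ofLp i) * (unitaryAct r.repr x).1.ofLp j))).re := by
    intro x
    rw [born_eq_sum_basis r, ← Complex.re_ofReal_mul, Finset.mul_sum]
    congr 1
    refine Finset.sum_congr rfl fun i _ => ?_
    rw [Finset.mul_sum]
    refine Finset.sum_congr rfl fun j _ => ?_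
    simp only [unitaryAct, hq]
    ring
  simp_rw [h1]
  -- Taking coordinates in the basis `r` is a unitary map, so invariance replaces `r` by the
  -- standard basis.
  rw [integral_uniformSphere_unitary r.repr fun y : HiddenVar d =>
    (∑ i, ∑ j, q i j * ((minIndicator a y.1.ofLp : ℂ) * (star (y.1.ofLp i) * y.1.ofLp j))).re]
  have h2 := integral_re (integrable_finsetSum Finset.univ fun i _ =>
    integrable_finsetSum Finset.univ fun j _ => hint i j)
  refine h2.trans ?_
  rw [integral_finsetSum _ fun i _ => integrable_finsetSum _ fun j _ => hint i j]
  simp_rw [integral_finsetSum _ fun j _ => hint _ j, integral_const_mul]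
  change (∑ i, ∑ j, q i j * minMoment a i j).re = _
  congr 1
  rw [trace_ketBra_mul, trace_eq_sum_basis r Q]
  have h3 : ∀ i, ∑ j, q i j * minMoment a i j = q i i * minMoment a i i := fun i =>
    Finset.sum_eq_single i (fun j _ hj => by rw [minMoment_off_diag a hj.symm, mul_zero])
      (by simp)
  simp_rw [h3]
  rw [← Finset.add_sum_erase _ _ (Finset.mem_univ a), minMoment_self hd0,
    Finset.sum_congr rfl fun i hi => by rw [minMoment_diag hd (Finset.ne_of_mem_erase hi)],
    ← Finset.sum_mul]
  conv_rhs => rw [← Finset.add_sum_erase _ _ (Finset.mem_univ a)]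
  have hd' : (d : ℂ) ≠ 0 := by exact_mod_cast hd0.ne'
  field_simp
  ring

/-! ### Alice's response almost everywhere -/

theorem born_basis {ι : Type} [Fintype ι]
    (r : OrthonormalBasis ι ℂ (EuclideanSpace ℂ (Fin d))) (x : HiddenVar d) (a : ι) :
    born x (ketBra (r a)) = ‖(r.repr x.1).ofLp a‖ ^ 2 := by
  rw [born_ketBra, r.repr_apply_apply]

theorem ProjMeasurement.IsRankOne.ae_existsUnique_min (hd : 0 < d) {n : ℕ}
    {P : ProjMeasurement (Fin d) (Fin n)} (hP : P.IsRankOne) :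
    ∀ᵐ x ∂uniformSphere d, ∃! a, ∀ k, born x (P.proj a) ≤ born x (P.proj k) := by
  obtain rfl := hP.eq_dim
  obtain ⟨r, hr⟩ := hP.exists_basis
  have hU : MeasurePreserving (unitaryAct r.repr) (uniformSphere n) (uniformSphere n) :=
    ⟨measurable_unitaryAct _, uniformSphere_map_unitaryAct _⟩
  filter_upwards [hU.quasiMeasurePreserving.ae (WernerModel.ae_existsUnique_min hd)] with x hx
  simp only [hr, born_basis, sq_le_sq₀ (norm_nonneg _) (norm_nonneg _)]
  exact hx

theorem IsMinimumResponse.ae_prob_eq (hd : 0 < d) {pA : ResponseFunction (Fin d) (HiddenVar d)}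
    (hpA : IsMinimumResponse pA) {R : ProjMeasurement (Fin d) (Fin d)} (hR : R.IsRankOne)
    {r : OrthonormalBasis (Fin d) ℂ (EuclideanSpace ℂ (Fin d))}
    (hr : ∀ a, R.proj a = ketBra (r a)) (a : Fin d) :
    ∀ᵐ x ∂uniformSphere d, pA.prob R x a = minIndicator a (r.repr x.1).ofLp := by
  filter_upwards [hR.ae_existsUnique_min hd] with x ⟨b, hb, hu⟩
  have hiff : (∀ k, ‖(r.repr x.1).ofLp a‖ ≤ ‖(r.repr x.1).ofLp k‖) ↔
      ∀ k, born x (R.proj a) ≤ born x (R.proj k) := by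
    simp only [hr, born_basis, sq_le_sq₀ (norm_nonneg _) (norm_nonneg _)]
  have hlt : ∀ k, k ≠ b → born x (R.proj b) < born x (R.proj k) := by
    intro k hk
    refine lt_of_not_ge fun hle => hk (hu k fun l => hle.trans (hb l))
  by_cases h : a = b
  · subst h
    rw [hpA.eq_one R hR x a hlt, minIndicator, Set.indicator_of_mem (by exact hiff.2 hb),
      Pi.one_apply]
  · rw [hpA.eq_zero R hR x a ⟨b, fun h' => h h'.symm, hlt a h⟩, minIndicator,
      Set.indicator_of_notMem (by exact fun h' => h (hu a (hiff.1 h')))]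

/-! ### Traces against the flip and reproduction of the statistics -/

theorem flipOperator_mul_apply (W : Matrix (Fin d × Fin d) (Fin d × Fin d) ℂ)
    (r s : Fin d × Fin d) : (flipOperator d * W) r s = W r.swap s := by
  rw [mul_apply, Finset.sum_eq_single r.swap]
  · simp [flipOperator]
  · intro b _ hb
    have : r ≠ b.swap := fun h => hb (by rw [h, Prod.swap_swap])
    simp [flipOperator, this]
  · simp

theorem mul_flipOperator_apply (W : Matrix (Fin d × Fin d) (Fin d × Fin d) ℂ)
    (r s : Fin d × Fin d) : (W * flipOperator d) r s = W r s.swap := by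
  rw [mul_apply, Finset.sum_eq_single s.swap]
  · simp [flipOperator]
  · intro b _ hb
    simp [flipOperator, hb]
  · simp

theorem trace_flipOperator_mul_kronecker (A B : Matrix (Fin d) (Fin d) ℂ) :
    (flipOperator d * (A ⊗ₖ B)).trace = (A * B).trace := by
  simp only [trace, diag_apply, flipOperator_mul_apply, kroneckerMap_apply,
    Fintype.sum_prod_type, Prod.swap_prod_mk]
  simp only [mul_apply]
  exact Finset.sum_comm

theorem trace_wernerLocal_mul_kronecker (A B : Matrix (Fin d) (Fin d) ℂ) :
    (wernerLocal d * (A ⊗ₖ B)).trace =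
      ((d : ℂ) + 1) / (d : ℂ) ^ 3 * (A.trace * B.trace) - 1 / (d : ℂ) ^ 2 * (A * B).trace := by
  rw [wernerLocal, sub_mul, trace_sub, smul_mul_assoc, smul_mul_assoc, trace_smul, trace_smul,
    one_mul, trace_kronecker, trace_flipOperator_mul_kronecker, smul_eq_mul, smul_eq_mul]

theorem trace_im_eq_zero_of_isHermitian {A B : Matrix (Fin d) (Fin d) ℂ} (hA : Aᴴ = A)
    (hB : Bᴴ = B) : (A * B).trace.im = 0 := by
  rw [← Complex.conj_eq_iff_im, starRingEnd_apply, ← trace_conjTranspose, conjTranspose_mul, hA,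
    hB, trace_mul_comm]

theorem IsMinimumResponse.reproduces (hd : 2 ≤ d) {pA : ResponseFunction (Fin d) (HiddenVar d)}
    (hpA : IsMinimumResponse pA) :
    Reproduces (uniformSphere d) pA (bornResponse d) (wernerLocal d) := by
  have hd0 : 0 < d := by omega
  have := isProbabilityMeasure_uniformSphere hd0
  intro k l P Q a b
  set B := Q.proj b
  have hB : Bᴴ = B := (Q.isStarProjection b).isSelfAdjoint
  obtain ⟨R, c, hR, hPR, hpR⟩ := hpA.coarse P
  obtain ⟨r, hr⟩ := hR.exists_basis
  have hrank : ∀ j, (wernerLocal d * (R.proj j ⊗ₖ B)).trace =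
      ((∫ x, pA.prob R x j * born x B ∂uniformSphere d : ℝ) : ℂ) := by
    intro j
    have h1 : ∫ x, pA.prob R x j * born x B ∂uniformSphere d =
        ∫ x : HiddenVar d, minIndicator j (r.repr x.1).ofLp * born x B ∂uniformSphere d := by
      refine integral_congr_ae ?_
      filter_upwards [hpA.ae_prob_eq hd0 hR hr j] with x hx
      rw [hx]
    have hRj : (R.proj j).trace = 1 := by
      rw [rank_eq_trace (R.isStarProjection j).isIdempotentElem, hR j, Nat.cast_one]
    -- The integral formula is a real part; it remains to see that the trace is real, as traces of
    -- products of two Hermitian matrices are.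
    rw [h1, integral_minIndicator_mul_born hd r j B, trace_wernerLocal_mul_kronecker, hRj, one_mul,
      ← hr j, eq_comm, ← Complex.conj_eq_iff_re, map_sub, map_mul, map_mul]
    have h2 : (starRingEnd ℂ) B.trace = B.trace := by
      have h := trace_im_eq_zero_of_isHermitian (conjTranspose_one (n := Fin d) (α := ℂ)) hB
      rw [one_mul] at h
      exact Complex.conj_eq_iff_im.2 h
    have h3 : (starRingEnd ℂ) (R.proj j * B).trace = (R.proj j * B).trace :=
      Complex.conj_eq_iff_im.2
        (trace_im_eq_zero_of_isHermitian (R.isStarProjection j).isSelfAdjoint hB)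
    rw [h2, h3]
    simp
  have hint : ∀ j, Integrable (fun x => pA.prob R x j * born x B) (uniformSphere d) := by
    intro j
    refine integrable_uniformSphere_of_bound hd0
      ((pA.measurable R j).mul (measurable_born B)) 1 fun x => ?_
    have h1 : pA.prob R x j ≤ 1 := (Finset.single_le_sum (fun i _ => pA.nonneg R x i)
      (Finset.mem_univ j)).trans (pA.sum_eq_one R x).le
    have h2 : born x B ≤ 1 := (Finset.single_le_sum
      (fun i _ => (bornResponse d).nonneg Q x i) (Finset.mem_univ b)).trans
      ((bornResponse d).sum_eq_one Q x).le
    have h3 : 0 ≤ born x B := born_nonneg x (Q.isStarProjection b)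
    rw [Real.norm_of_nonneg (mul_nonneg (pA.nonneg R x j) h3)]
    exact mul_le_one₀ h1 h3 h2
  have hleft : (wernerLocal d * (P.proj a ⊗ₖ B)).trace =
      ∑ j with c j = a, (wernerLocal d * (R.proj j ⊗ₖ B)).trace := by
    simp only [trace_wernerLocal_mul_kronecker, hPR a, trace_sum, Finset.sum_mul,
      Finset.mul_sum, Finset.sum_sub_distrib]
  rw [hleft, Finset.sum_congr rfl fun j _ => hrank j, ← Complex.ofReal_sum,
    ← integral_finsetSum _ fun j _ => hint j]
  simp_rw [hpR, Finset.sum_mul]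
  rfl

/-! ### Existence of a minimum response -/

open Classical in
/-- The response that chooses uniformly among the outcomes of minimal Born weight. -/
noncomputable def uniformMinProb {n : ℕ} (P : ProjMeasurement (Fin d) (Fin n)) (x : HiddenVar d)
    (a : Fin n) : ℝ :=
  (if ∀ k, born x (P.proj a) ≤ born x (P.proj k) then 1 else 0) /
    ∑ b, if ∀ k, born x (P.proj b) ≤ born x (P.proj k) then 1 else 0

theorem uniformMinProb_nonneg {n : ℕ} (P : ProjMeasurement (Fin d) (Fin n)) (x : HiddenVar d)
    (a : Fin n) : 0 ≤ uniformMinProb P x a := by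
  classical
  refine div_nonneg ?_ (Finset.sum_nonneg fun b _ => ?_) <;> split_ifs <;> norm_num

theorem sum_uniformMinProb {n : ℕ} (hn : 0 < n) (P : ProjMeasurement (Fin d) (Fin n))
    (x : HiddenVar d) : ∑ a, uniformMinProb P x a = 1 := by
  classical
  have : Nonempty (Fin n) := ⟨⟨0, hn⟩⟩
  obtain ⟨a, ha⟩ := Finite.exists_min fun k => born x (P.proj k)
  unfold uniformMinProb
  rw [← Finset.sum_div]
  refine div_self (ne_of_gt (Finset.sum_pos' (fun b _ => ?_) ⟨a, Finset.mem_univ a, ?_⟩))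
  · split_ifs <;> norm_num
  · rw [if_pos ha]; exact one_pos

theorem measurable_uniformMinProb {n : ℕ} (P : ProjMeasurement (Fin d) (Fin n)) (a : Fin n) :
    Measurable fun x => uniformMinProb P x a := by
  classical
  have hset : ∀ b, MeasurableSet {x : HiddenVar d | ∀ k, born x (P.proj b) ≤ born x (P.proj k)} := by
    intro b
    rw [Set.ofPred_forall]
    exact MeasurableSet.iInter fun k => measurableSet_le (measurable_born _) (measurable_born _)
  have hite : ∀ b, Measurable fun x : HiddenVar d =>
      if ∀ k, born x (P.proj b) ≤ born x (P.proj k) then (1 : ℝ) else 0 := fun b =>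
    Measurable.ite (hset b) measurable_const measurable_const
  unfold uniformMinProb
  exact (hite a).div (Finset.measurable_fun_sum _ fun b _ => hite b)

theorem uniformMinProb_eq_zero {n : ℕ} (P : ProjMeasurement (Fin d) (Fin n)) (x : HiddenVar d)
    {a k : Fin n} (h : born x (P.proj k) < born x (P.proj a)) : uniformMinProb P x a = 0 := by
  classical
  rw [uniformMinProb, if_neg fun h' => (h' k).not_gt h, zero_div]

theorem uniformMinProb_eq_one {n : ℕ} (hn : 0 < n) (P : ProjMeasurement (Fin d) (Fin n))
    (x : HiddenVar d) {a : Fin n}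
    (h : ∀ k, k ≠ a → born x (P.proj a) < born x (P.proj k)) : uniformMinProb P x a = 1 := by
  rw [← sum_uniformMinProb hn P x]
  exact (Finset.sum_eq_single a (fun b _ hb => uniformMinProb_eq_zero P x (h b hb))
    (by simp)).symm

theorem exists_refined_response (hd : 0 < d) {n : ℕ} (P : ProjMeasurement (Fin d) (Fin n)) :
    ∃ (R : ProjMeasurement (Fin d) (Fin d)) (c : Fin d → Fin n), R.IsRankOne ∧
      (∀ a, P.proj a = ∑ k with c k = a, R.proj k) ∧
      (P.IsRankOne → ∀ x a, ∑ k with c k = a, uniformMinProb R x k = uniformMinProb P x a) := by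
  by_cases hP : P.IsRankOne
  -- A rank-one measurement is refined by itself, so that the response defined through refinements
  -- agrees with the minimum rule on it.
  · obtain rfl := hP.eq_dim
    exact ⟨P, id, hP, fun a => by simp [Finset.filter_eq'], fun _ x a => by
      simp [Finset.filter_eq']⟩
  · obtain ⟨r, c, h⟩ := P.exists_basis
    exact ⟨basisMeasurement r, c, isRankOne_basisMeasurement r, h, fun h' => absurd h' hP⟩

theorem exists_isMinimumResponse (hd : 0 < d) :
    ∃ pA : ResponseFunction (Fin d) (HiddenVar d), IsMinimumResponse pA := by
  have key := fun (n : ℕ) (P : ProjMeasurement (Fin d) (Fin n)) => exists_refined_response hd P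
  choose R c hR hPR hPc using key
  refine ⟨⟨fun {n} P x a => ∑ k with c n P k = a, uniformMinProb (R n P) x k,
    fun P x a => Finset.sum_nonneg fun k _ => uniformMinProb_nonneg _ x k, fun {n} P x => ?_,
    fun P a => Finset.measurable_fun_sum _ fun k _ => measurable_uniformMinProb _ k⟩, ?_, ?_, ?_⟩
  · rw [Finset.sum_fiberwise, sum_uniformMinProb hd]
  · intro n P hP x a h
    have hn : 0 < n := by rw [hP.eq_dim]; exact hd
    exact (hPc n P hP x a).trans (uniformMinProb_eq_one hn P x h)
  · rintro n P hP x a ⟨k, _, h⟩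
    exact (hPc n P hP x a).trans (uniformMinProb_eq_zero P x h)
  · intro n P
    refine ⟨R n P, c n P, hR n P, hPR n P, fun x a => ?_⟩
    dsimp only
    exact Finset.sum_congr rfl fun k _ => (hPc d _ (hR n P) x k).symm

/-! ### Algebra of the flip and the Werner state -/

theorem flipOperator_mul_kronecker (A B : Matrix (Fin d) (Fin d) ℂ) :
    flipOperator d * (A ⊗ₖ B) = (B ⊗ₖ A) * flipOperator d := by
  ext r s
  rw [flipOperator_mul_apply, mul_flipOperator_apply, kroneckerMap_apply, kroneckerMap_apply,
    mul_comm]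
  rfl

theorem flipOperator_mul_self : flipOperator d * flipOperator d = 1 := by
  ext r s
  rw [flipOperator_mul_apply]
  simp [flipOperator, one_apply]

theorem conjTranspose_flipOperator : (flipOperator d)ᴴ = flipOperator d := by
  ext r s
  have : s = r.swap ↔ r = s.swap := ⟨fun h => by rw [h, Prod.swap_swap], fun h => by
    rw [h, Prod.swap_swap]⟩
  simp only [conjTranspose_apply, flipOperator, of_apply, this]
  split_ifs <;> simp

theorem trace_flipOperator : (flipOperator d).trace = d := by
  have h := trace_flipOperator_mul_kronecker (1 : Matrix (Fin d) (Fin d) ℂ) 1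
  simpa using h

theorem trace_one_prod : (1 : Matrix (Fin d × Fin d) (Fin d × Fin d) ℂ).trace = (d : ℂ) ^ 2 := by
  simp [sq]

theorem kronecker_conjTranspose_cancel {U : Matrix (Fin d) (Fin d) ℂ}
    (hU : U ∈ unitaryGroup (Fin d) ℂ) : (U ⊗ₖ U) * (Uᴴ ⊗ₖ Uᴴ) = 1 := by
  have h : U * Uᴴ = 1 := mem_unitaryGroup_iff.1 hU
  rw [← mul_kronecker_mul, h, one_kronecker_one]

theorem conjTranspose_kronecker_cancel {U : Matrix (Fin d) (Fin d) ℂ}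
    (hU : U ∈ unitaryGroup (Fin d) ℂ) : (Uᴴ ⊗ₖ Uᴴ) * (U ⊗ₖ U) = 1 := by
  have h : Uᴴ * U = 1 := mem_unitaryGroup_iff'.1 hU
  rw [← mul_kronecker_mul, h, one_kronecker_one]

theorem trace_wernerLocal (hd : 0 < d) : (wernerLocal d).trace = 1 := by
  have hd' : (d : ℂ) ≠ 0 := by exact_mod_cast hd.ne'
  rw [wernerLocal, trace_sub, trace_smul, trace_smul, trace_one_prod, trace_flipOperator]
  simp only [smul_eq_mul]
  field_simp
  ring

theorem trace_flipOperator_mul_wernerLocal (hd : 0 < d) :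
    (flipOperator d * wernerLocal d).trace =
      ((-1 + ((d : ℝ) + 1) / (d : ℝ) ^ 2 : ℝ) : ℂ) := by
  have hd' : (d : ℂ) ≠ 0 := by exact_mod_cast hd.ne'
  rw [wernerLocal, mul_sub, mul_smul_comm, mul_smul_comm, flipOperator_mul_self, mul_one,
    trace_sub, trace_smul, trace_smul, trace_one_prod, trace_flipOperator]
  simp only [smul_eq_mul]
  push_cast
  field_simp
  ring

theorem posSemidef_wernerLocal (hd : 0 < d) : (wernerLocal d).PosSemidef := by
  have hd' : (d : ℂ) ≠ 0 := by exact_mod_cast hd.ne'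
  have h1 : (1 : Matrix (Fin d × Fin d) (Fin d × Fin d) ℂ).PosSemidef := PosSemidef.one
  have h2 := posSemidef_conjTranspose_mul_self (1 - flipOperator d)
  -- Since `V` is a Hermitian involution, `(1 - V)ᴴ * (1 - V) = 2 (1 - V)`, and `(d+1)/d³ = 1/d³ +
  -- 1/d²`.
  have h3 : wernerLocal d = ((1 / d ^ 3 : ℝ) : ℂ) • 1 +
      ((1 / (2 * d ^ 2) : ℝ) : ℂ) • ((1 - flipOperator d)ᴴ * (1 - flipOperator d)) := by
    rw [conjTranspose_sub, conjTranspose_one, conjTranspose_flipOperator, sub_mul, mul_sub,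
      mul_sub, flipOperator_mul_self, wernerLocal]
    simp only [one_mul, mul_one]
    push_cast
    match_scalars <;> field_simp <;> ring
  rw [h3]
  refine (h1.smul ?_).add (h2.smul ?_)
  · exact Complex.zero_le_real.2 (by positivity)
  · exact Complex.zero_le_real.2 (by positivity)

theorem isWernerState_wernerLocal (hd : 0 < d) : IsWernerState (wernerLocal d) := by
  refine ⟨⟨posSemidef_wernerLocal hd, trace_wernerLocal hd⟩, fun U hU => ?_⟩
  have h : (U ⊗ₖ U) * wernerLocal d = wernerLocal d * (U ⊗ₖ U) := by
    rw [wernerLocal, mul_sub, sub_mul, mul_smul_comm, mul_smul_comm, smul_mul_assoc,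
      smul_mul_assoc, ← flipOperator_mul_kronecker, mul_one, one_mul]
  rw [h, mul_assoc, kronecker_conjTranspose_cancel hU, mul_one]

/-! ### The commutant of all `U ⊗ U` -/

theorem permutation_mem_unitaryGroup (σ : Equiv.Perm (Fin d)) :
    (1 : Matrix (Fin d) (Fin d) ℂ).submatrix σ id ∈ unitaryGroup (Fin d) ℂ := by
  rw [mem_unitaryGroup_iff, star_eq_conjTranspose, conjTranspose_submatrix, conjTranspose_one]
  have := submatrix_mul_equiv (1 : Matrix (Fin d) (Fin d) ℂ) 1 σ (Equiv.refl _) σ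
  rw [Equiv.coe_refl, one_mul, submatrix_one_equiv] at this
  exact this

theorem commutant_perm_apply {W : Matrix (Fin d × Fin d) (Fin d × Fin d) ℂ}
    (hW : ∀ U ∈ unitaryGroup (Fin d) ℂ, (U ⊗ₖ U) * W = W * (U ⊗ₖ U))
    (σ : Equiv.Perm (Fin d)) (i j k l : Fin d) :
    W (σ i, σ j) (σ k, σ l) = W (i, j) (k, l) := by
  have h := hW _ (permutation_mem_unitaryGroup σ)
  have h1 : (1 : Matrix (Fin d) (Fin d) ℂ).submatrix σ id ⊗ₖ
      (1 : Matrix (Fin d) (Fin d) ℂ).submatrix σ id =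
      (1 : Matrix (Fin d × Fin d) (Fin d × Fin d) ℂ).submatrix (σ.prodCongr σ) (Equiv.refl _) := by
    ext ⟨i, j⟩ ⟨k, l⟩
    simp [one_apply, ← ite_and, and_comm]
  rw [h1, one_submatrix_mul, mul_submatrix_one] at h
  have h2 := congrFun (congrFun h (i, j)) (σ k, σ l)
  simpa using h2

theorem commutant_apply_eq_zero {W : Matrix (Fin d × Fin d) (Fin d × Fin d) ℂ}
    (hW : ∀ U ∈ unitaryGroup (Fin d) ℂ, (U ⊗ₖ U) * W = W * (U ⊗ₖ U))
    {i j k l : Fin d}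
    (h : ¬ (k = i ∧ l = j) ∧ ¬ (k = j ∧ l = i)) : W (i, j) (k, l) = 0 := by
  by_contra hne
  have hp : ∀ p, (if i = p then Complex.I else 1) * (if j = p then Complex.I else 1) =
      (if k = p then Complex.I else 1) * (if l = p then Complex.I else 1) := by
    intro p
    -- The phase `i` at position `p` records how often `p` occurs in a pair: the counts 0, 1, 2 give
    -- `1`, `i`, `-1`. A sign `-1` would confuse 0 with 2.
    let θ : Fin d → ℂ := fun q => if q = p then Complex.I else 1
    have hU : diagonal θ ∈ unitaryGroup (Fin d) ℂ := by
      rw [mem_unitaryGroup_iff, star_eq_conjTranspose, diagonal_conjTranspose,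
        diagonal_mul_diagonal, ← diagonal_one]
      congr 1
      ext q
      by_cases hq : q = p <;> simp [θ, hq]
    have h1 := congrFun (congrFun (hW _ hU) (i, j)) (k, l)
    rw [diagonal_kronecker_diagonal, diagonal_mul, mul_diagonal, mul_comm] at h1
    exact mul_left_cancel₀ hne h1
  have h1 := hp i
  have h2 := hp j
  by_cases hij : i = j <;> by_cases hki : k = i <;> by_cases hli : l = i <;>
    by_cases hkj : k = j <;> by_cases hlj : l = j <;> simp_all [Complex.ext_iff]
  norm_num at h1

theorem commutant_eq {W : Matrix (Fin d × Fin d) (Fin d × Fin d) ℂ}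
    (hW : ∀ U ∈ unitaryGroup (Fin d) ℂ, (U ⊗ₖ U) * W = W * (U ⊗ₖ U))
    (hd : 2 ≤ d) : ∃ b c : ℂ, W = b • 1 + c • flipOperator d := by
  let i₀ : Fin d := ⟨0, by omega⟩
  let i₁ : Fin d := ⟨1, by omega⟩
  have h01 : i₀ ≠ i₁ := by simp [i₀, i₁, Fin.ext_iff]
  set a := W (i₀, i₀) (i₀, i₀) with ha
  set b := W (i₀, i₁) (i₀, i₁) with hb
  set c := W (i₀, i₁) (i₁, i₀) with hc
  have hσ : ∀ i j : Fin d, i ≠ j → ∃ σ : Equiv.Perm (Fin d), σ i₀ = i ∧ σ i₁ = j := by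
    intro i j hij
    have hs : (Equiv.swap i₀ i) i₁ ≠ i := by
      intro h
      rw [Equiv.swap_apply_eq_iff, Equiv.swap_apply_right] at h
      exact h01 h.symm
    refine ⟨Equiv.swap (Equiv.swap i₀ i i₁) j * Equiv.swap i₀ i, ?_, ?_⟩
    · rw [Equiv.Perm.mul_apply, Equiv.swap_apply_left, Equiv.swap_apply_of_ne_of_ne hs.symm hij]
    · rw [Equiv.Perm.mul_apply, Equiv.swap_apply_left]
  have haa : ∀ i, W (i, i) (i, i) = a := fun i => by
    simpa using commutant_perm_apply hW (Equiv.swap i₀ i) i₀ i₀ i₀ i₀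
  have hbb : ∀ i j, i ≠ j → W (i, j) (i, j) = b := by
    intro i j hij
    obtain ⟨σ, rfl, rfl⟩ := hσ i j hij
    exact commutant_perm_apply hW σ _ _ _ _
  have hcc : ∀ i j, i ≠ j → W (i, j) (j, i) = c := by
    intro i j hij
    obtain ⟨σ, rfl, rfl⟩ := hσ i j hij
    exact commutant_perm_apply hW σ _ _ _ _
  -- Phases and permutations leave three parameters; `D` is the projection onto the span of the
  -- `|ii⟩`, the extra direction to be excluded.
  let D : Matrix (Fin d × Fin d) (Fin d × Fin d) ℂ := diagonal fun r => if r.1 = r.2 then 1 else 0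
  have hdecomp : W = b • 1 + c • flipOperator d + (a - b - c) • D := by
    ext ⟨i, j⟩ ⟨k, l⟩
    simp only [Matrix.add_apply, Matrix.smul_apply, smul_eq_mul, one_apply, flipOperator, of_apply,
      D, diagonal_apply, Prod.swap_prod_mk, Prod.mk.injEq]
    by_cases h1 : k = i ∧ l = j
    · obtain ⟨rfl, rfl⟩ := h1
      by_cases h2 : k = l
      · subst h2
        simp [haa]
      · simp [hbb _ _ h2, h2]
    · by_cases h2 : k = j ∧ l = i
      · obtain ⟨rfl, rfl⟩ := h2
        have h3 : l ≠ k := fun h => h1 ⟨h.symm, h⟩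
        simp [hcc _ _ h3, h3]
      · rw [commutant_apply_eq_zero hW ⟨h1, h2⟩]
        have h3 : ¬ (i = k ∧ j = l) := fun h => h1 ⟨h.1.symm, h.2.symm⟩
        have h4 : ¬ (i = l ∧ j = k) := fun h => h2 ⟨h.2.symm, h.1.symm⟩
        simp [h3, h4]
  let S : Matrix (Fin d) (Fin d) ℂ := (1 : Matrix (Fin d) (Fin d) ℂ).submatrix (Equiv.swap i₀ i₁) id
  have hSS : S * S = 1 := by
    have h := one_submatrix_mul (Equiv.swap i₀ i₁) (Equiv.refl _) S
    refine h.trans ?_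
    ext i j
    simp only [S, submatrix_apply, Function.comp_apply, Equiv.refl_symm, Equiv.refl_apply]
    rw [← Equiv.Perm.mul_apply, Equiv.swap_mul_self, Equiv.Perm.one_apply]
    rfl
  have hSh : Sᴴ = S := by
    have h : S * Sᴴ = 1 := mem_unitaryGroup_iff.1 (permutation_mem_unitaryGroup _)
    calc Sᴴ = (S * S) * Sᴴ := by rw [hSS, one_mul]
      _ = S := by rw [mul_assoc, h, mul_one]
  -- A square root of the transposition `S`: its eigenvalues are `1` and `i` where those of `S` are
  -- `1` and `-1`. It mixes `i₀` with `i₁`, so `U ⊗ U` does not commute with `D`.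
  let U : Matrix (Fin d) (Fin d) ℂ :=
    ((1 + Complex.I) / 2) • (1 : Matrix (Fin d) (Fin d) ℂ) + ((1 - Complex.I) / 2) • S
  have hU : U ∈ unitaryGroup (Fin d) ℂ := by
    have hUh : Uᴴ = ((1 - Complex.I) / 2) • (1 : Matrix (Fin d) (Fin d) ℂ) +
        ((1 + Complex.I) / 2) • S := by
      simp only [U, conjTranspose_add, conjTranspose_smul, conjTranspose_one, hSh]
      congr 2 <;> simp [sub_eq_add_neg]
    rw [mem_unitaryGroup_iff, star_eq_conjTranspose, hUh]
    simp only [U, add_mul, mul_add, smul_mul_assoc, mul_smul_comm, one_mul, mul_one, hSS]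
    match_scalars <;> ring_nf <;> norm_num [Complex.I_sq]
  have hcomm := hW U hU
  rw [hdecomp] at hcomm
  simp only [mul_add, add_mul, mul_smul_comm, smul_mul_assoc, mul_one, one_mul,
    flipOperator_mul_kronecker, add_right_inj] at hcomm
  have hentry := congrFun (congrFun hcomm (i₀, i₀)) (i₁, i₀)
  have hU00 : U i₀ i₀ = (1 + Complex.I) / 2 := by
    simp [U, S, one_apply, h01.symm]
  have hU01 : U i₀ i₁ = (1 - Complex.I) / 2 := by
    simp [U, S, one_apply, h01]
  simp only [Matrix.smul_apply, D, mul_diagonal, diagonal_mul, kroneckerMap_apply, if_neg h01.symm,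
    ↓reduceIte, hU00, hU01, smul_eq_mul, mul_zero, one_mul] at hentry
  have hne : (1 - Complex.I) / 2 * ((1 + Complex.I) / 2) ≠ 0 := by
    have : (1 - Complex.I) / 2 * ((1 + Complex.I) / 2) = 1 / 2 := by
      ring_nf
      rw [Complex.I_sq]
      norm_num
    rw [this]
    norm_num
  have hz : a - b - c = 0 := (mul_eq_zero.1 hentry.symm).resolve_right hne
  exact ⟨b, c, by conv_lhs => rw [hdecomp, hz, zero_smul, add_zero]⟩

theorem IsWernerState.eq_wernerLocal (hd : 2 ≤ d)
    {W : Matrix (Fin d × Fin d) (Fin d × Fin d) ℂ} (hW : IsWernerState W)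
    (hφ : (flipOperator d * W).trace = ((-1 + ((d : ℝ) + 1) / (d : ℝ) ^ 2 : ℝ) : ℂ)) :
    W = wernerLocal d := by
  have hcomm : ∀ U ∈ unitaryGroup (Fin d) ℂ, (U ⊗ₖ U) * W = W * (U ⊗ₖ U) := by
    intro U hU
    conv_rhs => rw [← hW.2 U hU]
    rw [mul_assoc _ (Uᴴ ⊗ₖ Uᴴ), conjTranspose_kronecker_cancel hU, mul_one]
  obtain ⟨b, c, rfl⟩ := commutant_eq hcomm hd
  have h1 := hW.1.2
  rw [mul_add, mul_smul_comm, mul_smul_comm, flipOperator_mul_self, mul_one] at hφ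
  rw [trace_add, trace_smul, trace_smul, trace_one_prod, trace_flipOperator, smul_eq_mul,
    smul_eq_mul] at h1 hφ
  push_cast at hφ
  have hd0 : (d : ℂ) ≠ 0 := by exact_mod_cast (by omega : d ≠ 0)
  have hd1 : (d : ℂ) ^ 2 - 1 ≠ 0 := by
    rw [sub_ne_zero]
    exact_mod_cast (by nlinarith : d ^ 2 ≠ 1)
  have hc : c = -(1 / (d : ℂ) ^ 2) := by
    field_simp at hφ
    -- Eliminating `b` from `b d² + c d = 1` and the equation `b d + c d² = φ`.
    have h2 : ((d : ℂ) ^ 2 - 1) * (c * (d : ℂ) ^ 2 + 1) = 0 := by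
      linear_combination hφ - (d : ℂ) * h1
    have h3 := (mul_eq_zero.1 h2).resolve_left hd1
    field_simp
    linear_combination h3
  have hb : b = ((d : ℂ) + 1) / (d : ℂ) ^ 3 := by
    rw [hc] at h1
    field_simp at h1 ⊢
    linear_combination h1
  rw [hb, hc, wernerLocal, neg_smul, sub_eq_add_neg]

/-! ### Entanglement, with the flip as witness -/

-- With `A = Cᴴ C`, cyclicity gives the trace of the positive semidefinite matrix `C B Cᴴ`.
open scoped MatrixOrder in
theorem trace_mul_nonneg_of_posSemidef {A B : Matrix (Fin d) (Fin d) ℂ} (hA : A.PosSemidef)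
    (hB : B.PosSemidef) : 0 ≤ (A * B).trace.re := by
  obtain ⟨C, rfl⟩ := CStarAlgebra.nonneg_iff_eq_star_mul_self.1 hA.nonneg
  rw [star_eq_conjTranspose]
  rw [mul_assoc, trace_mul_comm]
  exact (Complex.le_def.1 (hB.mul_mul_conjTranspose_same C).trace_nonneg).1

theorem flip_expectation_neg (hd : 2 ≤ d) : -1 + ((d : ℝ) + 1) / (d : ℝ) ^ 2 < 0 := by
  have h : (2 : ℝ) ≤ d := by exact_mod_cast hd
  have h1 : ((d : ℝ) + 1) / (d : ℝ) ^ 2 < 1 := by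
    rw [div_lt_one (by positivity)]
    nlinarith
  linarith

theorem isEntangled_wernerLocal (hd : 2 ≤ d) : IsEntangled (wernerLocal d) := by
  have hd0 : 0 < d := by omega
  refine ⟨(isWernerState_wernerLocal hd0).1, ?_⟩
  rintro ⟨N, p, ρA, ρB, hp, -, hA, hB, hρ⟩
  have h := congrArg Complex.re (trace_flipOperator_mul_wernerLocal hd0)
  rw [hρ, Finset.mul_sum, trace_sum, Complex.re_sum, Complex.ofReal_re] at h
  -- A convex combination of product states would give the flip a nonnegative expectation.
  refine (flip_expectation_neg hd).not_ge (h ▸ Finset.sum_nonneg fun i _ => ?_)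
  rw [mul_smul_comm, trace_smul, trace_flipOperator_mul_kronecker, smul_eq_mul,
    Complex.re_ofReal_mul]
  exact mul_nonneg (hp i) (trace_mul_nonneg_of_posSemidef (hA i).1 (hB i).1)

end WernerModel

theorem mainTheorem1 (d : ℕ) (hd : 2 ≤ d) :
    -- the hidden variables are uniformly distributed, and this law is unitarily invariant
    (IsProbabilityMeasure (uniformSphere d) ∧
      ∀ U : EuclideanSpace ℂ (Fin d) ≃ₗᵢ[ℂ] EuclideanSpace ℂ (Fin d),
        (uniformSphere d).map (unitaryAct U) = uniformSphere d) ∧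
    -- Alice's minimising outcome is almost surely unique
    (∀ (n : ℕ) (P : ProjMeasurement (Fin d) (Fin n)), P.IsRankOne →
      ∀ᵐ x ∂(uniformSphere d), ∃! a, ∀ k, born x (P.proj a) ≤ born x (P.proj k)) ∧
    -- Alice's response function exists, and each choice of it reproduces the statistics
    (∃ pA : ResponseFunction (Fin d) (HiddenVar d), IsMinimumResponse pA) ∧
    (∀ pA : ResponseFunction (Fin d) (HiddenVar d), IsMinimumResponse pA →
      Reproduces (uniformSphere d) pA (bornResponse d) (wernerLocal d)) ∧
    -- the state reproduced is the one Werner state with the stated value of `tr (V W)`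
    (∀ W : Matrix (Fin d × Fin d) (Fin d × Fin d) ℂ,
      (IsWernerState W ∧
        (flipOperator d * W).trace = ((-1 + ((d : ℝ) + 1) / (d : ℝ) ^ 2 : ℝ) : ℂ)) ↔
      W = wernerLocal d) ∧
    -- this value is negative, and the state is entangled and has a local model
    (-1 + ((d : ℝ) + 1) / (d : ℝ) ^ 2 < 0) ∧
    IsEntangled (wernerLocal d) ∧
    AdmitsLocalModel (wernerLocal d) := by
  have hd0 : 0 < d := by omega
  have hprob := isProbabilityMeasure_uniformSphere hd0
  obtain ⟨pA, hpA⟩ := exists_isMinimumResponse hd0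
  refine ⟨⟨hprob, uniformSphere_map_unitaryAct⟩, fun n P hP => hP.ae_existsUnique_min hd0,
    ⟨pA, hpA⟩, fun pA hpA => hpA.reproduces hd, fun W => ⟨fun h => h.1.eq_wernerLocal hd h.2, ?_⟩,
    flip_expectation_neg hd, isEntangled_wernerLocal hd,
    ⟨HiddenVar d, inferInstance, uniformSphere d, hprob, pA, bornResponse d, hpA.reproduces hd⟩⟩
  rintro rfl
  exact ⟨isWernerState_wernerLocal hd0, trace_flipOperator_mul_wernerLocal hd0⟩
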